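/- Let $n\ge 0$, $r\ge 1$ and $0\le k\le n$. For $\sigma\subset\{1,\dots,n\}$ write $dx_\sigma=dx_{\sigma_1}\wedge\cdots\wedge dx_{\sigma_k}$ with $\sigma_1<\dots<\sigma_k$ the elements of $\sigma$. Let $\mathcal Q_r\Lambda^k$ be the span of the form monomials $x^\alpha dx_\sigma$ with $|\sigma|=k$ and $\alpha_i\le r$ for all $i$. Let $\mathcal Q_r^-\Lambda^k\subset\mathcal Q_r\Lambda^k$ be the span of those with $\alpha_i\neq r$ for all $i\in\sigma$, and let $\mathcal B_r\Lambda^k$ be the span of those with $\alpha_i=r$ for some $i\in\sigma$. Put $$\tilde{\mathcal Q}_r\Lambda^k=\mathcal Q_r^-\Lambda^k+d\kappa\,\mathcal B_r\Lambda^k,$$ where $\kappa$ is the Koszul operator (contraction with the vector field $x$). For a face $f$ of a box, i.e. of a Cartesian product of compact intervals, $\mathcal Q_s^-\Lambda^j(f)$ denotes the analogous space in the free coordinates of $f$ (for $s=0$ it consists of the constants if $j=0$ and is $0$ if $j>0$), and $\operatorname{tr}_f$ denotes the pullback of forms to $f$. Let $\Omega\subset\mathbb R^n$ be a bounded domain with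 a cubical mesh $\mathcal T_h$: finitely many nondegenerate boxes whose interiors lie in $\Omega$ and whose union is $\overline\Omega$, any two different ones being disjoint or meeting in a common face. Let $\tilde{\mathcal Q}_r\Lambda^k(\mathcal T_h)$ (resp. $\mathcal Q_r^-\Lambda^k(\mathcal T_h)$) be the space of piecewise polynomial $k$-forms $u$ with $u|_T\in\tilde{\mathcal Q}_r\Lambda^k$ (resp. $u|_T\in\mathcal Q_r^-\Lambda^k$) for all $T\in\mathcal T_h$, whose traces $\operatorname{tr}_f u$ are single-valued on every face $f$ common to two cells. Let $\Delta_l(\mathcal T_h)$ be the set of $l$-dimensional faces of cells of $\mathcal T_h$. **Theorem.** There is a linear map $\Pi_h:\tilde{\mathcal Q}_r\Lambda^k(\mathcal T_h)\to\mathcal Q_r^-\Lambda^k(\mathcal T_h)$ such that, for each $u\in\tilde{\mathcal Q}_r\Lambda^k(\mathcal T_h)$, $\Pi_hu$ is the unique element of $\mathcal Q_r^-\Lambda^k(\mathcal T_h)$ with $$\int_f\operatorname{tr}_f\Pi_hu\wedge v=\int_f\operatorname{tr}_fu\wedge v\qquad\text{for all } v\in\mathcal Q_{r-1}^-\Lambda^{l-k}(f),\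 f\in\Delta_l(\mathcal T_h),\ k\le l\le n .$$ It satisfies $$\|\Pi_hu\|_{L^2\Lambda^k(\Omega)}\le C\,\|u\|_{L^2\Lambda^k(\Omega)}\qquad\text{for all }u\in\tilde{\mathcal Q}_r\Lambda^k(\mathcal T_h),$$ with a constant $C>0$ that depends only on $n,k,r$ (not on $\Omega$, on the mesh or on the mesh size $h$), and $$d(u-\Pi_hu)=0\quad\text{in }\Omega\qquad\text{for all }u\in\tilde{\mathcal Q}_r\Lambda^k(\mathcal T_h),$$ where $d$ is the weak exterior derivative and $u-\Pi_hu\in L^2\Lambda^k(\Omega)$. -/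

import Mathlib

noncomputable section

namespace CubicalForms

/-! ### Polynomial differential forms on `ℝⁿ` -/

/-- Differential forms on `ℝⁿ` with polynomial coefficients, `u = ∑_σ u_σ dx_σ`.  An increasing
sequence `σ₁ < ⋯ < σ_k` is identified with its range, a finite subset `σ` of `Fin n`, and
`dx_σ = dx_{σ₁} ∧ ⋯ ∧ dx_{σ_k}`.  Forms of all degrees are collected in one type; the `k`-forms are
those whose coefficients vanish unless `|σ| = k`. -/
abbrev PolyForm (n : ℕ) : Type := Finset (Fin n) → MvPolynomial (Fin n) ℝ

variable {n : ℕ}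

/-- `ε(i, σ) = (-1)^l` with `l = |{j ∈ σ : j < i}|`, so that `dx_i ∧ dx_σ = ε(i, σ) dx_{σ + i}`
for `i ∉ σ`. -/
def eps (i : Fin n) (σ : Finset (Fin n)) : ℤ := (-1) ^ (σ.filter (fun j => j < i)).card

/-- The exterior derivative `d (∑ u_σ dx_σ) = ∑_σ ∑_i ∂_i u_σ dx_i ∧ dx_σ`. -/
def d : PolyForm n →ₗ[ℝ] PolyForm n where
  toFun u ρ := ∑ i ∈ ρ, eps i (ρ.erase i) • MvPolynomial.pderiv i (u (ρ.erase i))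
  map_add' u v := by
    funext ρ
    simp [Finset.sum_add_distrib, smul_add]
  map_smul' c u := by
    funext ρ
    simp only [Pi.smul_apply, RingHom.id_apply, Finset.smul_sum]
    refine Finset.sum_congr rfl fun i _ => ?_
    rw [Derivation.map_smul, smul_comm]

/-- The Koszul operator (contraction with the position vector `x`),
`κ (∑ u_σ dx_σ) = ∑_σ ∑_{i ∈ σ} ε(i, σ - i) x_i u_σ dx_{σ - i}`. -/
def kappa : PolyForm n →ₗ[ℝ] PolyForm n where
  toFun u τ := ∑ i ∈ τᶜ, eps i τ • (MvPolynomial.X i * u (insert i τ))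
  map_add' u v := by
    funext τ
    simp [Finset.sum_add_distrib, smul_add, mul_add]
  map_smul' c u := by
    funext τ
    simp only [Pi.smul_apply, RingHom.id_apply, Finset.smul_sum]
    refine Finset.sum_congr rfl fun i _ => ?_
    rw [mul_smul_comm, smul_comm]

/-- The sign with `dx_σ ∧ dx_τ = wedgeSign σ τ • dx_{σ ∪ τ}` for disjoint `σ`, `τ`. -/
def wedgeSign (σ τ : Finset (Fin n)) : ℤ :=
  (-1) ^ ((σ ×ˢ τ).filter (fun p => p.2 < p.1)).card

/-- The wedge product `u ∧ v`. -/
def wedge (u v : PolyForm n) : PolyForm n := fun ρ =>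
  ∑ σ ∈ ρ.powerset, wedgeSign σ (ρ \ σ) • (u σ * v (ρ \ σ))

/-- The form monomial `x^α dx_σ`. -/
def formMonomial (α : Fin n →₀ ℕ) (σ : Finset (Fin n)) : PolyForm n :=
  Pi.single σ (MvPolynomial.monomial α 1)

/-- The conforming `s`-degree of `x^α dx_σ`. -/
def cdeg (s : ℕ) (α : Fin n →₀ ℕ) (σ : Finset (Fin n)) : ℕ :=
  (σ.filter (fun i => α i = s)).card

/-- `x^α dx_σ` is a `k`-form in the variables `x_i`, `i ∈ I`, of degree at most `r` in each
variable, that is, it lies in `Q_r Λ^k` of a coordinate plane with free coordinates `I`. -/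
def IsQMonomial (I : Finset (Fin n)) (r k : ℕ) (α : Fin n →₀ ℕ) (σ : Finset (Fin n)) : Prop :=
  α.support ⊆ I ∧ σ ⊆ I ∧ σ.card = k ∧ ∀ i, α i ≤ r

/-- `Q_r^- Λ^k` in the variables `x_i`, `i ∈ I`; for `I = univ` it is `Q_r^- Λ^k` on `ℝⁿ`, and for
the set `I` of free coordinates of a face `f` it is `Q_r^- Λ^k(f)`. -/
def Qminus (I : Finset (Fin n)) (r k : ℕ) : Submodule ℝ (PolyForm n) :=
  Submodule.span ℝ {m | ∃ α σ, IsQMonomial I r k α σ ∧ cdeg r α σ = 0 ∧ m = formMonomial α σ}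

/-- `B_r Λ^k` on `ℝⁿ`. -/
def Bspace (n r k : ℕ) : Submodule ℝ (PolyForm n) :=
  Submodule.span ℝ {m | ∃ α σ, IsQMonomial Finset.univ r k α σ ∧ 0 < cdeg r α σ ∧
    m = formMonomial α σ}

/-- The enriched shape function space `Q_r^- Λ^k + d κ B_r Λ^k` on `ℝⁿ`. -/
def Qtilde (n r k : ℕ) : Submodule ℝ (PolyForm n) :=
  Qminus Finset.univ r k ⊔ (Bspace n r k).map (d ∘ₗ kappa)

/-! ### Cells, faces, traces and integrals over faces -/

/-- A nonempty closed Cartesian product of intervals, `∏ i, [lower i, upper i]`; intervals may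
degenerate to points, so that faces of cells are again of this kind. -/
@[ext]
structure Cell (n : ℕ) where
  lower : Fin n → ℝ
  upper : Fin n → ℝ
  le : ∀ i, lower i ≤ upper i

namespace Cell

/-- The underlying closed set. -/
def carrier (f : Cell n) : Set (Fin n → ℝ) := Set.Icc f.lower f.upper

/-- The free coordinates of `f`; their number is the dimension of `f`. -/
def dirs (f : Cell n) : Finset (Fin n) := Finset.univ.filter (fun i => f.lower i < f.upper i)

/-- `f` is a face of `T` (of any dimension, `T` itself included): in each coordinate it is the whole
interval of `T` or one of its end points. -/
def IsFaceOf (f T : Cell n) : Prop :=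
  ∀ i, (f.lower i = T.lower i ∧ f.upper i = T.upper i) ∨
    (f.lower i = T.lower i ∧ f.upper i = T.lower i) ∨
    (f.lower i = T.upper i ∧ f.upper i = T.upper i)

/-- The trace `tr_f u`, the pullback of `u` to the plane spanned by `f`: `dx_i` is sent to `0` and
`x_i` to its constant value on `f` for every coordinate `i` that is fixed on `f`. -/
def trace (f : Cell n) (u : PolyForm n) : PolyForm n := fun σ =>
  if σ ⊆ f.dirs then
    MvPolynomial.bind₁ (fun i => if i ∈ f.dirs then MvPolynomial.X i
      else MvPolynomial.C (f.lower i)) (u σ)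
  else 0

/-- The point of the plane of `f` with free coordinates `y`. -/
def embed (f : Cell n) (y : f.dirs → ℝ) : Fin n → ℝ :=
  fun i => if h : i ∈ f.dirs then y ⟨i, h⟩ else f.lower i

/-- `∫_f w`, where `f` is oriented by the increasing order of its free coordinates: the integral of
the coefficient of `dx_I`, `I` the set of free coordinates, against Lebesgue measure in these
coordinates (evaluation if `f` is a point). -/
def integral (f : Cell n) (w : PolyForm n) : ℝ :=
  ∫ y in Set.Icc (fun i : f.dirs => f.lower i) (fun i : f.dirs => f.upper i),
    MvPolynomial.eval (f.embed y) (w f.dirs)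

end Cell

/-! ### Meshes and finite element spaces -/

/-- A cubical mesh of `Ω`: finitely many nondegenerate Cartesian products of intervals, with
interiors in `Ω`, covering the closure of `Ω`, such that two different cells that meet do so in a
common face (so their interiors are disjoint).  In particular `Ω` is bounded and its boundary
lies in the union of finitely many faces. -/
structure CubicalMesh (Ω : Set (Fin n → ℝ)) where
  cells : Finset (Cell n)
  nondegenerate : ∀ T ∈ cells, ∀ i, T.lower i < T.upper i
  interior_subset : ∀ T ∈ cells, interior T.carrier ⊆ Ω
  closure_eq : closure Ω = ⋃ T ∈ cells, T.carrier
  face_to_face : ∀ T ∈ cells, ∀ T' ∈ cells, T ≠ T' → (T.carrier ∩ T'.carrier).Nonempty →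
    ∃ f : Cell n, f.IsFaceOf T ∧ f.IsFaceOf T' ∧ f.carrier = T.carrier ∩ T'.carrier

namespace CubicalMesh

variable {Ω : Set (Fin n → ℝ)}

/-- Piecewise polynomial forms: one polynomial form for each cell. -/
abbrev Broken (𝒯 : CubicalMesh Ω) : Type := 𝒯.cells → PolyForm n

/-- The finite element space with shape functions `S`: piecewise `S`, with single-valued trace on
every face common to two cells. -/
def femSpace (𝒯 : CubicalMesh Ω) (S : Submodule ℝ (PolyForm n)) : Submodule ℝ 𝒯.Broken where
  carrier := {u | (∀ T, u T ∈ S) ∧ ∀ (T T' : 𝒯.cells) (f : Cell n),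
    f.IsFaceOf T → f.IsFaceOf T' → f.trace (u T) = f.trace (u T')}
  add_mem' := by
    rintro u v ⟨hu, hu'⟩ ⟨hv, hv'⟩
    refine ⟨fun T => S.add_mem (hu T) (hv T), fun T T' f h h' => ?_⟩
    funext σ
    have h1 := congrFun (hu' T T' f h h') σ
    have h2 := congrFun (hv' T T' f h h') σ
    by_cases hσ : σ ⊆ f.dirs
    · simp only [Cell.trace, hσ, if_true] at h1 h2
      simp only [Cell.trace, hσ, if_true, Pi.add_apply, map_add, h1, h2]
    · simp [Cell.trace, hσ]
  zero_mem' := ⟨fun _ => S.zero_mem, fun _ _ _ _ _ => rfl⟩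
  smul_mem' := by
    rintro c u ⟨hu, hu'⟩
    refine ⟨fun T => S.smul_mem c (hu T), fun T T' f h h' => ?_⟩
    funext σ
    have h1 := congrFun (hu' T T' f h h') σ
    by_cases hσ : σ ⊆ f.dirs
    · simp only [Cell.trace, hσ, if_true] at h1
      simp only [Cell.trace, hσ, if_true, Pi.smul_apply, map_smul, h1]
    · simp [Cell.trace, hσ]

/-- `Q_r^- Λ^k(𝒯)`. -/
abbrev QminusSpace (𝒯 : CubicalMesh Ω) (r k : ℕ) : Submodule ℝ 𝒯.Broken :=
  𝒯.femSpace (Qminus Finset.univ r k)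

/-- The enriched finite element space of degree `r` and form degree `k` on `𝒯`. -/
abbrev QtildeSpace (𝒯 : CubicalMesh Ω) (r k : ℕ) : Submodule ℝ 𝒯.Broken :=
  𝒯.femSpace (Qtilde n r k)

/-- The piecewise polynomial form as a (coefficient-valued) function on `ℝⁿ`: it is `u T` in the
interior of each cell `T`, and `0` on the remaining null set of `Ω`. -/
def toForm (𝒯 : CubicalMesh Ω) (u : 𝒯.Broken) : (Fin n → ℝ) → Finset (Fin n) → ℝ :=
  fun x σ => ∑ T : 𝒯.cells,
    Set.indicator (interior T.1.carrier) (fun y => MvPolynomial.eval y (u T σ)) x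

/-- `u` and `w` have the same canonical degrees of freedom of `Q_r^- Λ^k(𝒯)`:
`∫_f tr_f w ∧ v = ∫_f tr_f u ∧ v` for all faces `f` of dimension `l ≥ k` and all
`v ∈ Q_{r-1}^- Λ^{l-k}(f)`. -/
def SameDOFs (𝒯 : CubicalMesh Ω) (r k : ℕ) (u w : 𝒯.Broken) : Prop :=
  ∀ (T : 𝒯.cells) (f : Cell n), f.IsFaceOf T → k ≤ f.dirs.card →
    ∀ v ∈ Qminus f.dirs (r - 1) (f.dirs.card - k),
      f.integral (wedge (f.trace (w T)) v) = f.integral (wedge (f.trace (u T)) v)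

end CubicalMesh

/-! ### The `L²` norm and the exterior derivative on `Ω` -/

/-- The `L²` norm of a differential form on `Ω` with coefficients `u x σ`. -/
def l2Norm (Ω : Set (Fin n → ℝ)) (u : (Fin n → ℝ) → Finset (Fin n) → ℝ) : ℝ :=
  Real.sqrt (∫ x in Ω, ∑ σ, (u x σ) ^ 2)

/-- `u` and `w` are in `L²(Ω)` and `w` is the (weak) exterior derivative of `u` in `Ω`. -/
def HasExtDeriv (Ω : Set (Fin n → ℝ)) (u w : (Fin n → ℝ) → Finset (Fin n) → ℝ) : Prop :=
  (∀ σ, MeasureTheory.MemLp (fun x => u x σ) 2 (MeasureTheory.volume.restrict Ω)) ∧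
  (∀ σ, MeasureTheory.MemLp (fun x => w x σ) 2 (MeasureTheory.volume.restrict Ω)) ∧
  ∀ φ : (Fin n → ℝ) → ℝ, ContDiff ℝ ((⊤ : ℕ∞) : WithTop ℕ∞) φ → HasCompactSupport φ →
    tsupport φ ⊆ Ω → ∀ ρ : Finset (Fin n),
      ∫ x in Ω, w x ρ * φ x =
        - ∫ x in Ω, ∑ i ∈ ρ,
            (eps i (ρ.erase i) : ℝ) * u x (ρ.erase i) * fderiv ℝ φ x (Pi.single i 1)

end CubicalForms

end

/-! In `Q_r^- Λ^k` the coefficient of `dx_σ` ranges over a tensor product: degree less than `r` in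
`x_i` for `i ∈ σ`, at most `r` for `i ∉ σ`. The canonical projection `proj` on a cell is therefore a
tensor product of univariate operators: the L² projection `l2Proj` in the directions of `σ`, and in
the others `interp`, which keeps end point values and the moments of order less than `r - 1`. They
are linked by `(interp p)' = l2Proj p'`, and the cellwise assertions reduce to facts in one
variable.

Degrees of freedom: on a face each of them is, up to sign, a product of end point evaluations and
moments applied to a single coefficient. `proj` preserves them all (`integral_proj`), and the
coefficients of `proj u` are combinations of them (`proj_congr_of_dofs`); so an element `w` of
`Q_r^- Λ^k` with the same degrees of freedom as `u` is `w = proj w = proj u`. Since `interp` keeps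
end point values, `tr_f (proj u)` depends only on `tr_f u` (`trace_proj`), and the cellwise
projections fit together.

Bound: `proj` acts on each coefficient separately and commutes with the affine map to the unit cube,
where a fixed operator acts on a fixed finite-dimensional space. The Jacobian occurs on both sides,
so no shape regularity enters.

Closedness: the univariate link makes `d` commute with `proj` (`d_proj`). For `u = q + dκb` the
projection fixes `q`, and `d` kills both `dκb` and `proj (dκb)`; so `u - proj u` is closed on each
cell. Against a test function, the divergence theorem leaves only facet integrals, which cancel
between neighbours because traces are single-valued (`SingleValued.sum_facet_eq`). -/

noncomputable section

namespace CubicalForms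

open Polynomial (aeval)

/-! ### Tensor products of univariate operators and functionals -/

variable {n : ℕ}

/-- The product `∏ᵢ pᵢ(xᵢ)` of univariate polynomials in separate variables, as a multilinear map. -/
def tens : MultilinearMap ℝ (fun _ : Fin n => Polynomial ℝ) (MvPolynomial (Fin n) ℝ) :=
  (MultilinearMap.mkPiAlgebra ℝ (Fin n) (MvPolynomial (Fin n) ℝ)).compLinearMap
    fun i => (aeval (MvPolynomial.X i : MvPolynomial (Fin n) ℝ)).toLinearMap

theorem tens_apply (p : Fin n → Polynomial ℝ) :
    tens p = ∏ i, aeval (MvPolynomial.X i : MvPolynomial (Fin n) ℝ) (p i) := by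
  simp [tens]

theorem tens_X_pow (α : Fin n →₀ ℕ) :
    tens (fun i => (Polynomial.X : Polynomial ℝ) ^ α i) = MvPolynomial.monomial α 1 := by
  rw [tens_apply, MvPolynomial.monomial_eq, Finsupp.prod_fintype _ _ (by simp)]
  simp

theorem eval_tens (p : Fin n → Polynomial ℝ) (x : Fin n → ℝ) :
    MvPolynomial.eval x (tens p) = ∏ i, (p i).eval (x i) := by
  rw [tens_apply, map_prod]
  refine Finset.prod_congr rfl fun i _ => ?_
  have := Polynomial.hom_eval₂ (p i) (algebraMap ℝ (MvPolynomial (Fin n) ℝ))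
    (MvPolynomial.eval x) (MvPolynomial.X i)
  rw [Polynomial.aeval_def, this, MvPolynomial.eval_X, Polynomial.eval,
    show (MvPolynomial.eval x).comp (algebraMap ℝ (MvPolynomial (Fin n) ℝ)) = RingHom.id ℝ from by
      ext; simp]

theorem tens_mul (p q : Fin n → Polynomial ℝ) :
    tens (fun i => p i * q i) = tens p * tens q := by
  simp [tens_apply, Finset.prod_mul_distrib]

variable {M : Type*} [AddCommGroup M] [Module ℝ M]

theorem hom_ext_monomial {f g : MvPolynomial (Fin n) ℝ →ₗ[ℝ] M}
    (h : ∀ α, f (MvPolynomial.monomial α 1) = g (MvPolynomial.monomial α 1)) : f = g := by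
  refine (MvPolynomial.basisMonomials (Fin n) ℝ).ext fun α => ?_
  simpa only [MvPolynomial.coe_basisMonomials] using h α

theorem hom_ext_tens {f g : MvPolynomial (Fin n) ℝ →ₗ[ℝ] M}
    (h : ∀ p, f (tens p) = g (tens p)) : f = g :=
  hom_ext_monomial fun α => by rw [← tens_X_pow, h]

/-- The linear map on polynomials induced by a multilinear map on tuples of univariate ones. -/
def lift (m : MultilinearMap ℝ (fun _ : Fin n => Polynomial ℝ) M) :
    MvPolynomial (Fin n) ℝ →ₗ[ℝ] M :=
  (MvPolynomial.basisMonomials (Fin n) ℝ).constr ℝ fun α => m fun i => Polynomial.X ^ α i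

theorem lift_monomial (m : MultilinearMap ℝ (fun _ : Fin n => Polynomial ℝ) M) (α : Fin n →₀ ℕ) :
    lift m (MvPolynomial.monomial α 1) = m fun i => Polynomial.X ^ α i := by
  have := (MvPolynomial.basisMonomials (Fin n) ℝ).constr_basis ℝ
    (fun α => m fun i => Polynomial.X ^ α i) α
  rwa [MvPolynomial.coe_basisMonomials] at this

/-- Both sides are multilinear in `p`, so it suffices to compare them on powers of `X`, where `lift`
is prescribed. -/
theorem lift_tens (m : MultilinearMap ℝ (fun _ : Fin n => Polynomial ℝ) M)
    (p : Fin n → Polynomial ℝ) : lift m (tens p) = m p := by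
  have : (lift m).compMultilinearMap tens = m := by
    refine Module.Basis.ext_multilinear (fun _ => Polynomial.basisMonomials ℝ) fun v => ?_
    have h : (fun i => Polynomial.basisMonomials ℝ (v i)) =
        fun i => (Polynomial.X : Polynomial ℝ) ^ (Finsupp.equivFunOnFinite.symm v) i := by
      funext i
      simp [Polynomial.X_pow_eq_monomial]
    rw [h, LinearMap.compMultilinearMap_apply, tens_X_pow, lift_monomial]
  exact congrArg (fun f => f p) this

/-- The tensor product of operators acting on the separate variables. -/
def tensOp (A : Fin n → Polynomial ℝ →ₗ[ℝ] Polynomial ℝ) :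
    MvPolynomial (Fin n) ℝ →ₗ[ℝ] MvPolynomial (Fin n) ℝ :=
  lift (tens.compLinearMap A)

/-- The tensor product of functionals acting on the separate variables. -/
def tensFun (μ : Fin n → Polynomial ℝ →ₗ[ℝ] ℝ) : MvPolynomial (Fin n) ℝ →ₗ[ℝ] ℝ :=
  lift ((MultilinearMap.mkPiAlgebra ℝ (Fin n) ℝ).compLinearMap μ)

@[simp] theorem tensOp_tens (A : Fin n → Polynomial ℝ →ₗ[ℝ] Polynomial ℝ)
    (p : Fin n → Polynomial ℝ) : tensOp A (tens p) = tens fun i => A i (p i) := by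
  simp [tensOp, lift_tens]

@[simp] theorem tensFun_tens (μ : Fin n → Polynomial ℝ →ₗ[ℝ] ℝ)
    (p : Fin n → Polynomial ℝ) : tensFun μ (tens p) = ∏ i, μ i (p i) := by
  simp [tensFun, lift_tens]

theorem tensOp_comp (A B : Fin n → Polynomial ℝ →ₗ[ℝ] Polynomial ℝ) :
    tensOp A ∘ₗ tensOp B = tensOp fun i => A i ∘ₗ B i :=
  hom_ext_tens fun p => by simp

theorem tensFun_comp (μ : Fin n → Polynomial ℝ →ₗ[ℝ] ℝ)
    (A : Fin n → Polynomial ℝ →ₗ[ℝ] Polynomial ℝ) :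
    tensFun μ ∘ₗ tensOp A = tensFun fun i => μ i ∘ₗ A i :=
  hom_ext_tens fun p => by simp

theorem tensOp_tensOp (A B : Fin n → Polynomial ℝ →ₗ[ℝ] Polynomial ℝ)
    (p : MvPolynomial (Fin n) ℝ) : tensOp A (tensOp B p) = tensOp (fun i => A i ∘ₗ B i) p :=
  LinearMap.congr_fun (tensOp_comp A B) p

theorem tensFun_tensOp (μ : Fin n → Polynomial ℝ →ₗ[ℝ] ℝ)
    (A : Fin n → Polynomial ℝ →ₗ[ℝ] Polynomial ℝ) (p : MvPolynomial (Fin n) ℝ) :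
    tensFun μ (tensOp A p) = tensFun (fun i => μ i ∘ₗ A i) p :=
  LinearMap.congr_fun (tensFun_comp μ A) p

/-- Multiplication by a monomial, partial differentiation and freezing of variables all act variable
by variable. Written as `tensOp`, they compose with the projection factor by factor. -/
theorem tensOp_mul_monomial (β : Fin n →₀ ℕ) (p : MvPolynomial (Fin n) ℝ) :
    p * MvPolynomial.monomial β 1 =
      tensOp (fun i => LinearMap.mulRight ℝ (Polynomial.X ^ β i)) p := by
  have : LinearMap.mulRight ℝ (MvPolynomial.monomial β (1 : ℝ)) =
      tensOp (fun i => LinearMap.mulRight ℝ (Polynomial.X ^ β i)) := by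
    refine hom_ext_tens fun p => ?_
    rw [LinearMap.mulRight_apply, ← tens_X_pow, ← tens_mul, tensOp_tens]
    rfl
  exact LinearMap.congr_fun this p

theorem pderiv_eq_tensOp (j : Fin n) (p : MvPolynomial (Fin n) ℝ) :
    MvPolynomial.pderiv j p =
      tensOp (fun i => if i = j then Polynomial.derivative else LinearMap.id) p := by
  have : (MvPolynomial.pderiv j : Derivation ℝ (MvPolynomial (Fin n) ℝ) _).toLinearMap =
      tensOp (fun i => if i = j then Polynomial.derivative else LinearMap.id) := by
    refine hom_ext_monomial fun α => ?_
    rw [Derivation.coeFn_coe, MvPolynomial.pderiv_monomial, ← tens_X_pow, tensOp_tens, one_mul,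
      ← mul_one (α j : ℝ), ← smul_eq_mul, ← MvPolynomial.smul_monomial, ← tens_X_pow, tens_apply,
      tens_apply, ← Finset.mul_prod_erase _ _ (Finset.mem_univ j),
      ← Finset.mul_prod_erase _ _ (Finset.mem_univ j), ← smul_mul_assoc]
    congr 1
    · simp [Polynomial.derivative_X_pow, MvPolynomial.smul_eq_C_mul]
    · refine Finset.prod_congr rfl fun i hi => ?_
      have : i ≠ j := Finset.ne_of_mem_erase hi
      simp [this]
  exact LinearMap.congr_fun this p

theorem bind₁_eq_tensOp (I : Finset (Fin n)) (a : Fin n → ℝ) (p : MvPolynomial (Fin n) ℝ) :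
    MvPolynomial.bind₁ (fun i => if i ∈ I then (MvPolynomial.X i : MvPolynomial (Fin n) ℝ)
      else MvPolynomial.C (a i)) p =
    tensOp (fun i => if i ∈ I then LinearMap.id
      else Polynomial.monomial 0 ∘ₗ Polynomial.leval (a i)) p := by
  have : (MvPolynomial.bind₁ (fun i => if i ∈ I then (MvPolynomial.X i : MvPolynomial (Fin n) ℝ)
      else MvPolynomial.C (a i))).toLinearMap =
    tensOp (fun i => if i ∈ I then LinearMap.id
      else Polynomial.monomial 0 ∘ₗ Polynomial.leval (a i)) := by
    refine hom_ext_monomial fun α => ?_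
    rw [AlgHom.toLinearMap_apply, MvPolynomial.bind₁_monomial, ← tens_X_pow, tensOp_tens,
      tens_apply, map_one, one_mul, Finset.prod_subset (Finset.subset_univ _)
        fun i _ hi => by rw [Finsupp.notMem_support_iff.1 hi, pow_zero]]
    refine Finset.prod_congr rfl fun i _ => ?_
    by_cases hi : i ∈ I <;> simp [hi, MvPolynomial.algebraMap_eq]
  exact LinearMap.congr_fun this p

theorem coeff_tens (p : Fin n → Polynomial ℝ) (α : Fin n →₀ ℕ) :
    MvPolynomial.coeff α (tens p) = ∏ i, (p i).coeff (α i) := by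
  have : (MvPolynomial.lcoeff ℝ α).compMultilinearMap tens =
      (MultilinearMap.mkPiAlgebra ℝ (Fin n) ℝ).compLinearMap
        (fun i => Polynomial.lcoeff ℝ (α i)) := by
    refine Module.Basis.ext_multilinear (fun _ => Polynomial.basisMonomials ℝ) fun v => ?_
    have h : (fun i => Polynomial.basisMonomials ℝ (v i)) =
        fun i => (Polynomial.X : Polynomial ℝ) ^ (Finsupp.equivFunOnFinite.symm v) i := by
      funext i
      simp [Polynomial.X_pow_eq_monomial]
    rw [h, LinearMap.compMultilinearMap_apply, tens_X_pow]
    by_cases hv : Finsupp.equivFunOnFinite.symm v = α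
    · subst hv
      simp
    · obtain ⟨i, hi⟩ : ∃ i, v i ≠ α i := by
        by_contra! hh
        exact hv (by ext i; simpa using hh i)
      rw [MvPolynomial.lcoeff_apply, MvPolynomial.coeff_monomial, if_neg hv]
      symm
      simp only [MultilinearMap.compLinearMap_apply, MultilinearMap.mkPiAlgebra_apply]
      refine Finset.prod_eq_zero (Finset.mem_univ i) ?_
      simp [Polynomial.coeff_X_pow, hi.symm]
  exact congrArg (fun f => f p) this

theorem coeff_tensOp (A : Fin n → Polynomial ℝ →ₗ[ℝ] Polynomial ℝ) (α : Fin n →₀ ℕ)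
    (p : MvPolynomial (Fin n) ℝ) : MvPolynomial.coeff α (tensOp A p) =
      tensFun (fun i => Polynomial.lcoeff ℝ (α i) ∘ₗ A i) p := by
  have : MvPolynomial.lcoeff ℝ α ∘ₗ tensOp A =
      tensFun (fun i => Polynomial.lcoeff ℝ (α i) ∘ₗ A i) :=
    hom_ext_tens fun p => by simp [coeff_tens]
  exact LinearMap.congr_fun this p

/-- The value of a tensor product functional is multilinear in its factors. -/
def tensFunAt (p : MvPolynomial (Fin n) ℝ) :
    MultilinearMap ℝ (fun _ : Fin n => Polynomial ℝ →ₗ[ℝ] ℝ) ℝ :=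
  ∑ α ∈ p.support, MvPolynomial.coeff α p •
    (MultilinearMap.mkPiAlgebra ℝ (Fin n) ℝ).compLinearMap
      (fun i => LinearMap.applyₗ (Polynomial.X ^ α i))

theorem tensFunAt_apply (p : MvPolynomial (Fin n) ℝ) (μ : Fin n → Polynomial ℝ →ₗ[ℝ] ℝ) :
    tensFunAt p μ = tensFun μ p := by
  conv_rhs => rw [p.as_sum]
  simp only [tensFunAt, sum_apply, map_sum]
  refine Finset.sum_congr rfl fun α _ => ?_
  rw [← mul_one (MvPolynomial.coeff α p), ← smul_eq_mul, ← MvPolynomial.smul_monomial, map_smul,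
    ← tens_X_pow, tensFun_tens]
  simp

theorem _root_.MultilinearMap.eq_zero_of_mem_span {ι R E : Type*} {N : Type*} [Fintype ι]
    [DecidableEq ι] [CommRing R] [AddCommGroup E] [Module R E] [AddCommGroup N] [Module R N]
    (f : MultilinearMap R (fun _ : ι => E) N) (S : ι → Set E)
    (h : ∀ v : ι → E, (∀ i, v i ∈ S i) → f v = 0) (v : ι → E)
    (hv : ∀ i, v i ∈ Submodule.span R (S i)) : f v = 0 := by
  -- Slots in `s` already range over the spans, the others still over the generators; `s` grows by
  -- one slot at a time.
  suffices H : ∀ s : Finset ι, ∀ v : ι → E, (∀ i ∈ s, v i ∈ Submodule.span R (S i)) →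
      (∀ i ∉ s, v i ∈ S i) → f v = 0 from
    H Finset.univ v (fun i _ => hv i) (fun i hi => absurd (Finset.mem_univ i) hi)
  intro s
  induction s using Finset.induction_on with
  | empty => exact fun v _ h2 => h v fun i => h2 i (by simp)
  | insert j s hj ih =>
    intro v h1 h2
    have key : Submodule.span R (S j) ≤ LinearMap.ker (f.toLinearMap v j) := by
      rw [Submodule.span_le]
      intro x hx
      rw [SetLike.mem_coe, LinearMap.mem_ker, MultilinearMap.toLinearMap_apply]
      refine ih _ (fun i hi => ?_) (fun i hi => ?_)
      · have : i ≠ j := fun e => hj (e ▸ hi)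
        simpa [this] using h1 i (Finset.mem_insert_of_mem hi)
      · by_cases e : i = j
        · subst e
          simpa using hx
        · simpa [e] using h2 i (by simp [e, hi])
    have := key (h1 j (Finset.mem_insert_self _ _))
    rwa [LinearMap.mem_ker, MultilinearMap.toLinearMap_apply, Function.update_eq_self] at this

/-- For unisolvence: if all products of the univariate degrees of freedom vanish at `p`, so does
every product of their linear combinations. -/
theorem tensFun_eq_zero_of_mem_span (p : MvPolynomial (Fin n) ℝ)
    (S : Fin n → Set (Polynomial ℝ →ₗ[ℝ] ℝ))
    (h : ∀ μ : Fin n → Polynomial ℝ →ₗ[ℝ] ℝ, (∀ i, μ i ∈ S i) → tensFun μ p = 0)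
    (ν : Fin n → Polynomial ℝ →ₗ[ℝ] ℝ) (hν : ∀ i, ν i ∈ Submodule.span ℝ (S i)) :
    tensFun ν p = 0 := by
  rw [← tensFunAt_apply]
  exact (tensFunAt p).eq_zero_of_mem_span S
    (fun v hv => by rw [tensFunAt_apply]; exact h v hv) ν hν

end CubicalForms

end

/-! ### Univariate projection and interpolation -/

noncomputable section

namespace CubicalForms

open Polynomial (degreeLT)

/-- `p ↦ ∫ₐᵇ p`. -/
def polyInt (a b : ℝ) : Polynomial ℝ →ₗ[ℝ] ℝ where
  toFun p := ∫ x in a..b, p.eval x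
  map_add' p q := by
    simp only [Polynomial.eval_add]
    exact intervalIntegral.integral_add (p.continuous.intervalIntegrable _ _)
      (q.continuous.intervalIntegrable _ _)
  map_smul' c p := by simp

theorem polyInt_apply (a b : ℝ) (p : Polynomial ℝ) : polyInt a b p = ∫ x in a..b, p.eval x := rfl

theorem polyInt_derivative (a b : ℝ) (p : Polynomial ℝ) :
    polyInt a b (Polynomial.derivative p) = p.eval b - p.eval a :=
  intervalIntegral.integral_eq_sub_of_hasDerivAt (fun x _ => p.hasDerivAt x)
    ((Polynomial.continuous _).intervalIntegrable _ _)

theorem polyInt_derivative_mul (a b : ℝ) (p q : Polynomial ℝ) :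
    polyInt a b (Polynomial.derivative p * q) =
      p.eval b * q.eval b - p.eval a * q.eval a - polyInt a b (p * Polynomial.derivative q) := by
  have := polyInt_derivative a b (p * q)
  rw [Polynomial.derivative_mul, map_add, Polynomial.eval_mul, Polynomial.eval_mul] at this
  linarith

theorem eq_zero_of_polyInt_mul_self {a b : ℝ} (hab : a < b) {p : Polynomial ℝ}
    (h : polyInt a b (p * p) = 0) : p = 0 := by
  by_contra hp
  obtain ⟨c, hc, hc'⟩ : ∃ c ∈ Set.Icc a b, p.eval c ≠ 0 := by
    by_contra! H
    exact hp (Polynomial.eq_zero_of_infinite_isRoot p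
      ((Set.Icc_infinite hab).mono fun x hx => H x hx))
  have : 0 < polyInt a b (p * p) :=
    intervalIntegral.integral_pos hab (p * p).continuous.continuousOn
      (fun x _ => by rw [Polynomial.eval_mul]; exact mul_self_nonneg _)
      ⟨c, hc, by rw [Polynomial.eval_mul]; exact mul_self_pos.2 hc'⟩
  exact this.ne' h

/-- The substitution `x ↦ a + h x`. -/
def affineComp (a h : ℝ) : Polynomial ℝ →ₗ[ℝ] Polynomial ℝ where
  toFun p := p.comp (Polynomial.C h * Polynomial.X + Polynomial.C a)
  map_add' _ _ := Polynomial.add_comp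
  map_smul' _ _ := Polynomial.smul_comp _ _ _

theorem affineComp_apply (a h : ℝ) (p : Polynomial ℝ) :
    affineComp a h p = p.comp (Polynomial.C h * Polynomial.X + Polynomial.C a) := rfl

theorem affineComp_mul (a h : ℝ) (p q : Polynomial ℝ) :
    affineComp a h (p * q) = affineComp a h p * affineComp a h q :=
  Polynomial.mul_comp _ _ _

theorem eval_affineComp (a h x : ℝ) (p : Polynomial ℝ) :
    (affineComp a h p).eval x = p.eval (h * x + a) := by
  simp [affineComp_apply]

theorem polyInt_affineComp (a b : ℝ) (p : Polynomial ℝ) :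
    (b - a) * polyInt 0 1 (affineComp a (b - a) p) = polyInt a b p := by
  simp only [polyInt_apply, eval_affineComp]
  rw [← smul_eq_mul, intervalIntegral.smul_integral_comp_mul_add (fun x => p.eval x)]
  simp

theorem affineComp_mem_degreeLT (a h : ℝ) {r : ℕ} {p : Polynomial ℝ}
    (hp : p ∈ degreeLT ℝ r) : affineComp a h p ∈ degreeLT ℝ r := by
  rcases eq_or_ne p 0 with rfl | h0
  · simp
  rw [Polynomial.mem_degreeLT] at hp ⊢
  refine lt_of_le_of_lt (Polynomial.degree_le_natDegree) ?_
  rw [Polynomial.degree_eq_natDegree h0] at hp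
  refine lt_of_le_of_lt ?_ hp
  norm_cast
  refine Polynomial.natDegree_comp_le.trans ?_
  calc _ ≤ p.natDegree * 1 := Nat.mul_le_mul_left _ Polynomial.natDegree_linear_le
    _ = _ := mul_one _

theorem affineComp_affineComp_inv {a h : ℝ} (hh : h ≠ 0) (p : Polynomial ℝ) :
    affineComp a h (affineComp (-a / h) h⁻¹ p) = p := by
  refine Polynomial.funext fun x => ?_
  rw [eval_affineComp, eval_affineComp]
  congr 1
  field_simp
  ring

theorem derivative_affineComp (a h : ℝ) (p : Polynomial ℝ) :
    Polynomial.derivative (affineComp a h p) = h • affineComp a h (Polynomial.derivative p) := by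
  simp [affineComp_apply, Polynomial.derivative_comp, Polynomial.smul_eq_C_mul]

/-- The antiderivative vanishing at `0`. -/
def antideriv : Polynomial ℝ →ₗ[ℝ] Polynomial ℝ :=
  (Polynomial.basisMonomials ℝ).constr ℝ fun m => Polynomial.monomial (m + 1) ((m + 1 : ℝ)⁻¹)

theorem antideriv_monomial (m : ℕ) :
    antideriv (Polynomial.monomial m 1) = Polynomial.monomial (m + 1) ((m + 1 : ℝ)⁻¹) := by
  have := (Polynomial.basisMonomials ℝ).constr_basis ℝ
    (fun m => Polynomial.monomial (m + 1) ((m + 1 : ℝ)⁻¹)) m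
  rwa [Polynomial.coe_basisMonomials] at this

theorem derivative_antideriv (p : Polynomial ℝ) :
    Polynomial.derivative (antideriv p) = p := by
  have : Polynomial.derivative ∘ₗ antideriv = LinearMap.id := by
    refine (Polynomial.basisMonomials ℝ).ext fun m => ?_
    have hm : (m : ℝ) + 1 ≠ 0 := by positivity
    simp only [Polynomial.coe_basisMonomials, LinearMap.comp_apply, antideriv_monomial]
    simp [hm]
  exact LinearMap.congr_fun this p

theorem antideriv_mem_degreeLT {r : ℕ} {p : Polynomial ℝ} (hp : p ∈ degreeLT ℝ r) :
    antideriv p ∈ degreeLT ℝ (r + 1) := by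
  rw [Polynomial.degreeLT_eq_span_X_pow] at hp
  refine (Submodule.span_le (p := (degreeLT ℝ (r + 1)).comap antideriv)).2 ?_ hp
  intro q hq
  simp only [Finset.coe_image, Set.mem_image, Finset.coe_range, Set.mem_Iio] at hq
  obtain ⟨m, hm, rfl⟩ := hq
  rw [SetLike.mem_coe, Submodule.mem_comap, Polynomial.X_pow_eq_monomial, antideriv_monomial,
    Polynomial.mem_degreeLT]
  refine (Polynomial.degree_monomial_le _ _).trans_lt ?_
  exact_mod_cast Nat.succ_lt_succ hm

theorem eq_of_derivative_eq {a : ℝ} {p q : Polynomial ℝ}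
    (h : Polynomial.derivative p = Polynomial.derivative q) (ha : p.eval a = q.eval a) : p = q := by
  have h0 : Polynomial.derivative (p - q) = 0 := by rw [map_sub, h, sub_self]
  have h1 := Polynomial.eq_C_of_natDegree_eq_zero
    (Polynomial.derivative_eq_zero.1 h0)
  have h2 : (p - q).eval a = 0 := by rw [Polynomial.eval_sub, ha, sub_self]
  rw [h1, Polynomial.eval_C] at h2
  rw [h2, map_zero] at h1
  exact sub_eq_zero.1 h1

/-- The form `∫ p q` is positive definite on the finite-dimensional space `degreeLT ℝ r` and
identifies it with its dual; `L p` represents the functional `q ↦ ∫ p q`. -/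
theorem exists_l2Proj {a b : ℝ} (hab : a < b) (r : ℕ) :
    ∃ L : Polynomial ℝ →ₗ[ℝ] Polynomial ℝ, ∀ p, L p ∈ degreeLT ℝ r ∧
      ∀ q ∈ degreeLT ℝ r, polyInt a b (L p * q) = polyInt a b (p * q) := by
  let B : Polynomial ℝ →ₗ[ℝ] degreeLT ℝ r →ₗ[ℝ] ℝ :=
    ((LinearMap.mul ℝ (Polynomial ℝ)).compr₂ (polyInt a b)).compl₂ (degreeLT ℝ r).subtype
  have hB : ∀ p q, B p q = polyInt a b (p * q) := fun p q => rfl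
  let Φ : degreeLT ℝ r →ₗ[ℝ] Module.Dual ℝ (degreeLT ℝ r) := B ∘ₗ (degreeLT ℝ r).subtype
  have : FiniteDimensional ℝ (degreeLT ℝ r) :=
    Module.Finite.equiv (Polynomial.degreeLTEquiv ℝ r).symm
  have hΦ : Function.Injective Φ := by
    rw [injective_iff_map_eq_zero]
    intro p hp
    have : polyInt a b (p * p) = 0 := LinearMap.congr_fun hp p
    exact Subtype.ext (eq_zero_of_polyInt_mul_self hab this)
  let e := Φ.linearEquivOfInjective hΦ Subspace.dual_finrank_eq.symm
  refine ⟨(degreeLT ℝ r).subtype ∘ₗ e.symm.toLinearMap ∘ₗ B, fun p => ⟨Subtype.property _, ?_⟩⟩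
  intro q hq
  have h1 : Φ (e.symm (B p)) = B p := e.apply_symm_apply (B p)
  exact LinearMap.congr_fun h1 ⟨q, hq⟩

/-- The `L²([a, b])`-orthogonal projection onto the polynomials of degree less than `r`. -/
def l2Proj (a b : ℝ) (r : ℕ) : Polynomial ℝ →ₗ[ℝ] Polynomial ℝ :=
  if h : a < b then (exists_l2Proj h r).choose else 0

section l2Proj

variable {a b : ℝ} (hab : a < b) {r : ℕ}
include hab

theorem l2Proj_mem (p : Polynomial ℝ) : l2Proj a b r p ∈ degreeLT ℝ r := by
  rw [l2Proj, dif_pos hab]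
  exact ((exists_l2Proj hab r).choose_spec p).1

theorem polyInt_l2Proj_mul (p : Polynomial ℝ) {q : Polynomial ℝ} (hq : q ∈ degreeLT ℝ r) :
    polyInt a b (l2Proj a b r p * q) = polyInt a b (p * q) := by
  rw [l2Proj, dif_pos hab]
  exact ((exists_l2Proj hab r).choose_spec p).2 q hq

theorem l2Proj_eq {p q : Polynomial ℝ} (hq : q ∈ degreeLT ℝ r)
    (h : ∀ s ∈ degreeLT ℝ r, polyInt a b (p * s) = polyInt a b (q * s)) :
    l2Proj a b r p = q := by
  rw [← sub_eq_zero]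
  have hm := (degreeLT ℝ r).sub_mem (l2Proj_mem hab p) hq
  refine eq_zero_of_polyInt_mul_self hab ?_
  rw [sub_mul, map_sub, polyInt_l2Proj_mul hab p hm, h _ hm, sub_self]

theorem l2Proj_of_mem {p : Polynomial ℝ} (hp : p ∈ degreeLT ℝ r) : l2Proj a b r p = p :=
  l2Proj_eq hab hp fun _ _ => rfl

theorem l2Proj_eq_zero_of_moments {p : Polynomial ℝ}
    (h : ∀ j < r, polyInt a b (p * Polynomial.X ^ j) = 0) : l2Proj a b r p = 0 := by
  refine l2Proj_eq hab (Submodule.zero_mem _) fun s hs => ?_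
  rw [zero_mul, map_zero]
  rw [Polynomial.degreeLT_eq_span_X_pow] at hs
  refine (Submodule.span_le
    (p := LinearMap.ker (polyInt a b ∘ₗ LinearMap.mulLeft ℝ p))).2 ?_ hs
  intro q hq
  simp only [Finset.coe_image, Set.mem_image, Finset.coe_range, Set.mem_Iio] at hq
  obtain ⟨m, hm, rfl⟩ := hq
  exact h m hm

theorem l2Proj_affineComp (p : Polynomial ℝ) :
    l2Proj 0 1 r (affineComp a (b - a) p) = affineComp a (b - a) (l2Proj a b r p) := by
  have hba : b - a ≠ 0 := (sub_pos.2 hab).ne'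
  refine l2Proj_eq one_pos (affineComp_mem_degreeLT _ _ (l2Proj_mem hab p)) fun s hs => ?_
  -- Every test polynomial on `[0, 1]` is the pullback of one on `[a, b]`, of the same degree.
  rw [← affineComp_affineComp_inv (a := a) hba s, ← affineComp_mul, ← affineComp_mul]
  refine mul_left_cancel₀ hba ?_
  rw [polyInt_affineComp, polyInt_affineComp,
    polyInt_l2Proj_mul hab p (affineComp_mem_degreeLT _ _ hs)]

end l2Proj

/-- The interpolation operator of degree `r` on `[a, b]` which preserves the values at the end
points and the moments of order less than `r - 1`. -/
def interp (a b : ℝ) (r : ℕ) : Polynomial ℝ →ₗ[ℝ] Polynomial ℝ :=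
  (antideriv ∘ₗ l2Proj a b r ∘ₗ Polynomial.derivative) +
    Polynomial.monomial 0 ∘ₗ Polynomial.leval a ∘ₗ
      (LinearMap.id - antideriv ∘ₗ l2Proj a b r ∘ₗ Polynomial.derivative)

theorem interp_apply (a b : ℝ) (r : ℕ) (p : Polynomial ℝ) :
    interp a b r p = antideriv (l2Proj a b r (Polynomial.derivative p)) +
      Polynomial.C (p.eval a - (antideriv (l2Proj a b r (Polynomial.derivative p))).eval a) := by
  simp [interp]

theorem eval_left_interp (a b : ℝ) (r : ℕ) (p : Polynomial ℝ) :
    (interp a b r p).eval a = p.eval a := by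
  simp [interp_apply]

/-- Built into the definition of `interp` as an antiderivative plus a constant; this is the
univariate source of `d_proj`. -/
theorem derivative_interp (a b : ℝ) (r : ℕ) (p : Polynomial ℝ) :
    Polynomial.derivative (interp a b r p) = l2Proj a b r (Polynomial.derivative p) := by
  simp [interp_apply, derivative_antideriv]

section interp

variable {a b : ℝ} (hab : a < b) {r : ℕ}
include hab

/-- For `r ≥ 1` the constant `1` is an admissible test polynomial, so `l2Proj` preserves `∫ p'`, the
increment of `p` over `[a, b]`. The left value is already right. -/
theorem eval_right_interp (hr : 1 ≤ r) (p : Polynomial ℝ) :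
    (interp a b r p).eval b = p.eval b := by
  have h1 := polyInt_derivative a b (interp a b r p)
  have h2 := polyInt_l2Proj_mul (r := r) hab (Polynomial.derivative p) (q := 1) (by
    rw [Polynomial.mem_degreeLT, Polynomial.degree_one]; exact_mod_cast hr)
  rw [mul_one, mul_one, polyInt_derivative] at h2
  rw [derivative_interp, h2, eval_left_interp] at h1
  linarith

theorem interp_mem (p : Polynomial ℝ) : interp a b r p ∈ degreeLT ℝ (r + 1) := by
  rw [interp_apply]
  refine Submodule.add_mem _ (antideriv_mem_degreeLT (l2Proj_mem hab _)) ?_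
  rw [Polynomial.mem_degreeLT]
  exact Polynomial.degree_C_le.trans_lt (by exact_mod_cast Nat.succ_pos r)

theorem interp_of_mem {p : Polynomial ℝ} (hp : p ∈ degreeLT ℝ (r + 1)) : interp a b r p = p := by
  refine eq_of_derivative_eq (a := a) ?_ (eval_left_interp _ _ _ _)
  rw [derivative_interp]
  refine l2Proj_of_mem hab ?_
  rcases eq_or_ne p 0 with rfl | h0
  · simp
  rw [Polynomial.mem_degreeLT] at hp ⊢
  refine (Polynomial.degree_derivative_lt h0).trans_le ?_
  rw [Polynomial.degree_eq_natDegree h0] at hp ⊢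
  exact_mod_cast Nat.lt_succ_iff.1 (by exact_mod_cast hp)

/-- Write `x^j` as the derivative of `x^(j+1)/(j+1)` and integrate by parts. The boundary terms
agree, and what remains is `l2Proj p'` tested against degree `j + 1 < r`: hence the shift in the
order of the moments. -/
theorem polyInt_interp_mul (hr : 1 ≤ r) (p : Polynomial ℝ) {j : ℕ} (hj : j + 1 < r) :
    polyInt a b (interp a b r p * Polynomial.X ^ j) = polyInt a b (p * Polynomial.X ^ j) := by
  have hd : Polynomial.derivative (Polynomial.monomial (j + 1) ((j + 1 : ℝ)⁻¹)) =
      Polynomial.X ^ j := by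
    have hm : (j : ℝ) + 1 ≠ 0 := by positivity
    simp [hm, Polynomial.X_pow_eq_monomial]
  have hq : Polynomial.monomial (j + 1) ((j + 1 : ℝ)⁻¹) ∈ degreeLT ℝ r := by
    rw [Polynomial.mem_degreeLT]
    exact (Polynomial.degree_monomial_le _ _).trans_lt (by exact_mod_cast hj)
  rw [← hd]
  have h1 := polyInt_derivative_mul a b (interp a b r p)
    (Polynomial.monomial (j + 1) ((j + 1 : ℝ)⁻¹))
  have h2 := polyInt_derivative_mul a b p (Polynomial.monomial (j + 1) ((j + 1 : ℝ)⁻¹))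
  rw [derivative_interp, polyInt_l2Proj_mul hab _ hq, eval_left_interp,
    eval_right_interp hab hr] at h1
  linarith

/-- Integration by parts turns the moment of `p'` of order `j` into boundary terms and `j` times the
moment of `p` of order `j - 1`, so `l2Proj p' = 0`. -/
theorem interp_eq_zero_of_dofs {p : Polynomial ℝ} (ha : p.eval a = 0) (hb : p.eval b = 0)
    (h : ∀ j, j + 1 < r → polyInt a b (p * Polynomial.X ^ j) = 0) : interp a b r p = 0 := by
  refine eq_of_derivative_eq (a := a) ?_ (by rw [eval_left_interp, ha, Polynomial.eval_zero])
  rw [derivative_interp, Polynomial.derivative_zero]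
  refine l2Proj_eq_zero_of_moments hab fun j hj => ?_
  rw [polyInt_derivative_mul, ha, hb]
  rcases j with _ | j
  · simp
  · rw [Polynomial.derivative_X_pow, mul_left_comm, ← Polynomial.smul_eq_C_mul, map_smul]
    simp [h j hj]

theorem interp_affineComp (p : Polynomial ℝ) :
    interp 0 1 r (affineComp a (b - a) p) = affineComp a (b - a) (interp a b r p) := by
  refine eq_of_derivative_eq (a := 0) ?_ ?_
  · rw [derivative_interp, derivative_affineComp, derivative_affineComp, derivative_interp,
      map_smul, l2Proj_affineComp hab]
  · rw [eval_left_interp, eval_affineComp, eval_affineComp, mul_zero, zero_add, eval_left_interp]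

end interp

/-- The functional `p ↦ ∫ₐᵇ p xʲ`. -/
def moment (a b : ℝ) (j : ℕ) : Polynomial ℝ →ₗ[ℝ] ℝ :=
  polyInt a b ∘ₗ LinearMap.mulRight ℝ (Polynomial.X ^ j)

theorem _root_.Submodule.mem_span_of_finite_of_ker {K E : Type*} [Field K] [AddCommGroup E]
    [Module K E] {S : Set (E →ₗ[K] K)} (hS : S.Finite) {f : E →ₗ[K] K}
    (h : ∀ x, (∀ μ ∈ S, μ x = 0) → f x = 0) : f ∈ Submodule.span K S := by
  have := hS.to_subtype
  have := mem_span_of_iInf_ker_le_ker (L := fun μ : S => (μ : E →ₗ[K] K)) (K := f)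
    fun x hx => h x fun μ hμ => by
      rw [Submodule.mem_iInf] at hx
      exact hx ⟨μ, hμ⟩
  rwa [Subtype.range_coe] at this

/-- The projection vanishes wherever the moments do, so each coefficient of its value, as a
functional, is a combination of the moments. The next lemma is the analogue for `interp`. -/
theorem lcoeff_comp_l2Proj_mem_span {a b : ℝ} (hab : a < b) (r m : ℕ) :
    Polynomial.lcoeff ℝ m ∘ₗ l2Proj a b r ∈
      Submodule.span ℝ (moment a b '' {j | j < r}) := by
  refine Submodule.mem_span_of_finite_of_ker ((Set.finite_lt_nat r).image _) fun p hp => ?_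
  rw [LinearMap.comp_apply, l2Proj_eq_zero_of_moments hab, map_zero]
  exact fun j hj => hp _ ⟨j, hj, rfl⟩

theorem lcoeff_comp_interp_mem_span {a b : ℝ} (hab : a < b) (r m : ℕ) :
    Polynomial.lcoeff ℝ m ∘ₗ interp a b r ∈
      Submodule.span ℝ ({Polynomial.leval a, Polynomial.leval b} ∪
        moment a b '' {j | j + 1 < r}) := by
  have hf : {j | j + 1 < r}.Finite := (Set.finite_lt_nat r).subset fun j hj =>
    (Nat.lt_succ_self j).trans hj
  refine Submodule.mem_span_of_finite_of_ker
    (((Set.finite_singleton _).insert _).union (hf.image _)) fun p hp => ?_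
  rw [LinearMap.comp_apply, interp_eq_zero_of_dofs hab, map_zero]
  · exact hp (Polynomial.leval a) (by simp)
  · exact hp (Polynomial.leval b) (by simp)
  · exact fun j hj => hp _ (Or.inr ⟨j, hj, rfl⟩)

end CubicalForms

end

/-! ### The canonical projection on a cell and its traces -/

noncomputable section

namespace CubicalForms

open Polynomial (degreeLT)

variable {n : ℕ}

/-- Polynomials of degree less than `δ i` in the variable `x_i`, for all `i`. -/
def boxDeg (δ : Fin n → ℕ) : Submodule ℝ (MvPolynomial (Fin n) ℝ) :=
  MvPolynomial.restrictSupport ℝ {α | ∀ i, α i < δ i}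

theorem mem_boxDeg {δ : Fin n → ℕ} {p : MvPolynomial (Fin n) ℝ} :
    p ∈ boxDeg δ ↔ ∀ α, MvPolynomial.coeff α p ≠ 0 → ∀ i, α i < δ i := by
  rw [boxDeg, MvPolynomial.mem_restrictSupport_iff]
  simp only [Set.subset_def, Finset.mem_coe, MvPolynomial.mem_support_iff, Set.mem_ofPred_eq]

theorem monomial_mem_boxDeg {δ : Fin n → ℕ} {α : Fin n →₀ ℕ} (h : ∀ i, α i < δ i) :
    (MvPolynomial.monomial α 1 : MvPolynomial (Fin n) ℝ) ∈ boxDeg δ := by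
  rw [mem_boxDeg]
  intro β hβ
  rw [MvPolynomial.coeff_monomial] at hβ
  rwa [← (ite_ne_right_iff.1 hβ).1]

theorem boxDeg_eq_span (δ : Fin n → ℕ) :
    boxDeg δ = Submodule.span ℝ ((fun α => MvPolynomial.monomial α (1 : ℝ)) ''
      {α | ∀ i, α i < δ i}) := by
  refine le_antisymm (fun p hp => ?_) (Submodule.span_le.2 ?_)
  · rw [p.as_sum]
    refine Submodule.sum_mem _ fun α hα => ?_
    rw [← mul_one (MvPolynomial.coeff α p), ← smul_eq_mul, ← MvPolynomial.smul_monomial]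
    exact Submodule.smul_mem _ _ (Submodule.subset_span
      ⟨α, mem_boxDeg.1 hp α (MvPolynomial.mem_support_iff.1 hα), rfl⟩)
  · rintro _ ⟨α, hα, rfl⟩
    exact monomial_mem_boxDeg hα

theorem boxDeg_mono {δ δ' : Fin n → ℕ} (h : ∀ i, δ i ≤ δ' i) : boxDeg δ ≤ boxDeg δ' :=
  fun _ hp => mem_boxDeg.2 fun α hα i => (mem_boxDeg.1 hp α hα i).trans_le (h i)

theorem X_pow_mem_degreeLT {j r : ℕ} (h : j < r) :
    (Polynomial.X : Polynomial ℝ) ^ j ∈ degreeLT ℝ r := by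
  rw [Polynomial.mem_degreeLT, Polynomial.degree_X_pow]
  exact_mod_cast h

theorem tens_mem_boxDeg {δ : Fin n → ℕ} {p : Fin n → Polynomial ℝ}
    (hp : ∀ i, p i ∈ degreeLT ℝ (δ i)) : tens p ∈ boxDeg δ := by
  rw [mem_boxDeg]
  intro α hα i
  by_contra! hi
  refine hα ?_
  rw [coeff_tens]
  refine Finset.prod_eq_zero (Finset.mem_univ i) (Polynomial.coeff_eq_zero_of_degree_lt ?_)
  exact (Polynomial.mem_degreeLT.1 (hp i)).trans_le (by exact_mod_cast hi)

theorem tensOp_mem_boxDeg {δ δ' : Fin n → ℕ} {A : Fin n → Polynomial ℝ →ₗ[ℝ] Polynomial ℝ}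
    (hA : ∀ i, ∀ p ∈ degreeLT ℝ (δ i), A i p ∈ degreeLT ℝ (δ' i))
    {p : MvPolynomial (Fin n) ℝ} (hp : p ∈ boxDeg δ) : tensOp A p ∈ boxDeg δ' := by
  rw [boxDeg_eq_span] at hp
  refine (Submodule.span_le (p := (boxDeg δ').comap (tensOp A))).2 ?_ hp
  rintro _ ⟨α, hα, rfl⟩
  simp only [SetLike.mem_coe, Submodule.mem_comap, ← tens_X_pow, tensOp_tens]
  exact tens_mem_boxDeg fun i => hA i _ (X_pow_mem_degreeLT (hα i))

theorem tensOp_mem_boxDeg_of_range {δ : Fin n → ℕ}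
    {A : Fin n → Polynomial ℝ →ₗ[ℝ] Polynomial ℝ}
    (hA : ∀ i p, A i p ∈ degreeLT ℝ (δ i)) (p : MvPolynomial (Fin n) ℝ) :
    tensOp A p ∈ boxDeg δ := by
  -- Any polynomial has some degree bounds, read off from its support.
  have hp : p ∈ boxDeg (fun i => p.support.sup (fun α => α i) + 1) := mem_boxDeg.2 fun α hα i =>
    Nat.lt_succ_of_le (Finset.le_sup (f := fun α : Fin n →₀ ℕ => α i)
      (MvPolynomial.mem_support_iff.2 hα))
  exact tensOp_mem_boxDeg (fun i q _ => hA i q) hp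

theorem tensOp_eq_self {δ : Fin n → ℕ} {A : Fin n → Polynomial ℝ →ₗ[ℝ] Polynomial ℝ}
    (hA : ∀ i, ∀ p ∈ degreeLT ℝ (δ i), A i p = p)
    {p : MvPolynomial (Fin n) ℝ} (hp : p ∈ boxDeg δ) : tensOp A p = p := by
  rw [boxDeg_eq_span] at hp
  refine (Submodule.span_le (p := LinearMap.eqLocus (tensOp A) LinearMap.id)).2 ?_ hp
  rintro _ ⟨α, hα, rfl⟩
  simp only [SetLike.mem_coe, LinearMap.mem_eqLocus, ← tens_X_pow, tensOp_tens, LinearMap.id_apply]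
  congr 1
  funext i
  exact hA i _ (X_pow_mem_degreeLT (hα i))

/-- The degree bounds of the coefficient of `dx_σ` in `Q_r^- Λ^k`. -/
def qminusDeg (r : ℕ) (σ : Finset (Fin n)) (i : Fin n) : ℕ := if i ∈ σ then r else r + 1

/-- `α_i ≤ r` together with `α_i ≠ r` on `σ` means `α_i < r` there. With `mem_Qminus` this describes
`Q_r^- Λ^k` coefficient by coefficient. -/
theorem Qminus_le {r k : ℕ} {u : PolyForm n} (hu : u ∈ Qminus Finset.univ r k)
    (σ : Finset (Fin n)) : u σ ∈ boxDeg (qminusDeg r σ) ∧ (σ.card ≠ k → u σ = 0) := by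
  induction hu using Submodule.span_induction with
  | mem u hu =>
    obtain ⟨α, τ, ⟨-, -, hk, hr⟩, hc, rfl⟩ := hu
    by_cases h : σ = τ
    · subst h
      simp only [formMonomial, Pi.single_eq_same]
      refine ⟨monomial_mem_boxDeg fun i => ?_, fun h => absurd hk h⟩
      rw [qminusDeg]
      split_ifs with hi
      · refine lt_of_le_of_ne (hr i) fun e => ?_
        rw [cdeg, Finset.card_eq_zero, Finset.filter_eq_empty_iff] at hc
        exact hc hi e
      · exact Nat.lt_succ_of_le (hr i)
    · simp [formMonomial, h]
  | zero => simp
  | add u v _ _ hu hv =>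
    exact ⟨Submodule.add_mem _ hu.1 hv.1, fun h => by
      rw [Pi.add_apply, hu.2 h, hv.2 h, add_zero]⟩
  | smul c u _ hu =>
    exact ⟨Submodule.smul_mem _ _ hu.1, fun h => by
      rw [Pi.smul_apply, hu.2 h, smul_zero]⟩

theorem mem_Qminus {r k : ℕ} {u : PolyForm n}
    (h : ∀ σ, u σ ∈ boxDeg (qminusDeg r σ)) (h0 : ∀ σ, σ.card ≠ k → u σ = 0) :
    u ∈ Qminus Finset.univ r k := by
  have hu : u = ∑ σ, LinearMap.single ℝ (fun _ => MvPolynomial (Fin n) ℝ) σ (u σ) := by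
    simp only [LinearMap.coe_single]
    exact (Finset.univ_sum_single u).symm
  rw [hu]
  refine Submodule.sum_mem _ fun σ _ => ?_
  by_cases hσ : σ.card = k
  · have hs := h σ
    rw [boxDeg_eq_span] at hs
    refine (Submodule.span_le (p := (Qminus Finset.univ r k).comap
      (LinearMap.single ℝ (fun _ => MvPolynomial (Fin n) ℝ) σ))).2 ?_ hs
    rintro _ ⟨α, hα, rfl⟩
    refine Submodule.subset_span ⟨α, σ, ⟨Finset.subset_univ _, Finset.subset_univ _, hσ,
      fun i => ?_⟩, ?_, rfl⟩
    · have := hα i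
      rw [qminusDeg] at this
      split_ifs at this <;> omega
    · rw [cdeg, Finset.card_eq_zero, Finset.filter_eq_empty_iff]
      intro i hi
      have := hα i
      rw [qminusDeg, if_pos hi] at this
      exact this.ne
  · rw [h0 σ hσ, map_zero]
    exact Submodule.zero_mem _

/-- The one-dimensional factors of the canonical projection onto `Q_r^- Λ^k` on a cell. -/
def projDir (T : Cell n) (r : ℕ) (σ : Finset (Fin n)) (i : Fin n) :
    Polynomial ℝ →ₗ[ℝ] Polynomial ℝ :=
  if i ∈ σ then l2Proj (T.lower i) (T.upper i) r else interp (T.lower i) (T.upper i) r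

/-- The canonical projection onto `Q_r^- Λ^k` on a cell. -/
def proj (T : Cell n) (r : ℕ) : PolyForm n →ₗ[ℝ] PolyForm n :=
  LinearMap.pi fun σ => tensOp (projDir T r σ) ∘ₗ LinearMap.proj σ

theorem proj_apply (T : Cell n) (r : ℕ) (u : PolyForm n) (σ : Finset (Fin n)) :
    proj T r u σ = tensOp (projDir T r σ) (u σ) := rfl

section Nondegenerate

variable {T : Cell n} (hT : ∀ i, T.lower i < T.upper i)
include hT

theorem proj_mem_Qminus {r k : ℕ} {u : PolyForm n} (h0 : ∀ σ, σ.card ≠ k → u σ = 0) :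
    proj T r u ∈ Qminus Finset.univ r k := by
  refine mem_Qminus (fun σ => ?_) fun σ hσ => by rw [proj_apply, h0 σ hσ, map_zero]
  refine tensOp_mem_boxDeg_of_range (fun i p => ?_) _
  rw [projDir, qminusDeg]
  split_ifs
  · exact l2Proj_mem (hT i) p
  · exact interp_mem (hT i) p

theorem proj_of_mem_Qminus {r k : ℕ} {u : PolyForm n} (hu : u ∈ Qminus Finset.univ r k) :
    proj T r u = u := by
  funext σ
  refine tensOp_eq_self (fun i p hp => ?_) (Qminus_le hu σ).1
  rw [projDir]
  rw [qminusDeg] at hp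
  split_ifs at hp ⊢
  · exact l2Proj_of_mem (hT i) hp
  · exact interp_of_mem (hT i) hp

end Nondegenerate

namespace Cell

theorem mem_dirs {f : Cell n} {i : Fin n} : i ∈ f.dirs ↔ f.lower i < f.upper i := by
  simp [dirs]

theorem IsFaceOf.eq_of_mem_dirs {f T : Cell n} (h : f.IsFaceOf T) {i : Fin n} (hi : i ∈ f.dirs) :
    f.lower i = T.lower i ∧ f.upper i = T.upper i := by
  rw [mem_dirs] at hi
  rcases h i with h | ⟨h1, h2⟩ | ⟨h1, h2⟩
  · exact h
  · rw [h1, h2] at hi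
    exact absurd hi (lt_irrefl _)
  · rw [h1, h2] at hi
    exact absurd hi (lt_irrefl _)

theorem IsFaceOf.lower_eq {f T : Cell n} (h : f.IsFaceOf T) (i : Fin n) :
    f.lower i = T.lower i ∨ f.lower i = T.upper i := by
  rcases h i with h | h | h
  · exact Or.inl h.1
  · exact Or.inl h.1
  · exact Or.inr h.1

/-- The one-dimensional factors of the trace. -/
def traceDir (f : Cell n) (i : Fin n) : Polynomial ℝ →ₗ[ℝ] Polynomial ℝ :=
  if i ∈ f.dirs then LinearMap.id else Polynomial.monomial 0 ∘ₗ Polynomial.leval (f.lower i)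

theorem trace_of_subset (f : Cell n) (u : PolyForm n) {σ : Finset (Fin n)} (hσ : σ ⊆ f.dirs) :
    f.trace u σ = tensOp f.traceDir (u σ) := by
  rw [trace, if_pos hσ]
  exact bind₁_eq_tensOp _ _ _

theorem trace_of_not_subset (f : Cell n) (u : PolyForm n) {σ : Finset (Fin n)}
    (hσ : ¬ σ ⊆ f.dirs) : f.trace u σ = 0 := if_neg hσ

end Cell

theorem eval_interp_endpoint {a b c : ℝ} (hab : a < b) {r : ℕ} (hr : 1 ≤ r)
    (hc : c = a ∨ c = b) : Polynomial.leval c ∘ₗ interp a b r = Polynomial.leval c := by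
  refine LinearMap.ext fun p => ?_
  rcases hc with rfl | rfl
  · exact eval_left_interp _ _ _ _
  · exact eval_right_interp hab hr _

/-- In a free direction of `f` the intervals of `f` and `T` coincide. A fixed direction is not in
`σ`, so its factor is `interp`, which evaluation at an end point does not notice. The operator on
the right involves `f` only, hence is the same for all cells sharing `f`. -/
theorem trace_proj {T f : Cell n} (hT : ∀ i, T.lower i < T.upper i) {r : ℕ} (hr : 1 ≤ r)
    (hf : f.IsFaceOf T) (u : PolyForm n) {σ : Finset (Fin n)} (hσ : σ ⊆ f.dirs) :
    f.trace (proj T r u) σ =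
      tensOp (fun i => if i ∈ f.dirs then projDir f r σ i else LinearMap.id) (f.trace u σ) := by
  rw [f.trace_of_subset _ hσ, f.trace_of_subset _ hσ, proj_apply, tensOp_tensOp, tensOp_tensOp]
  congr 2
  funext i
  by_cases hi : i ∈ f.dirs
  · obtain ⟨h1, h2⟩ := hf.eq_of_mem_dirs hi
    simp only [Cell.traceDir, if_pos hi, projDir, h1, h2, LinearMap.id_comp, LinearMap.comp_id]
  · have hiσ : i ∉ σ := fun h => hi (hσ h)
    simp only [Cell.traceDir, if_neg hi, projDir, if_neg hiσ, LinearMap.id_comp,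
      LinearMap.comp_assoc]
    rw [eval_interp_endpoint (hT i) hr (hf.lower_eq i)]

theorem trace_proj_congr {T T' f : Cell n} (hT : ∀ i, T.lower i < T.upper i)
    (hT' : ∀ i, T'.lower i < T'.upper i) {r : ℕ} (hr : 1 ≤ r)
    (hf : f.IsFaceOf T) (hf' : f.IsFaceOf T') {u u' : PolyForm n} (h : f.trace u = f.trace u') :
    f.trace (proj T r u) = f.trace (proj T' r u') := by
  funext σ
  by_cases hσ : σ ⊆ f.dirs
  · rw [trace_proj hT hr hf u hσ, trace_proj hT' hr hf' u' hσ, h]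
  · rw [f.trace_of_not_subset _ hσ, f.trace_of_not_subset _ hσ]

end CubicalForms

end

/-! ### Degrees of freedom and unisolvence -/

noncomputable section

namespace CubicalForms

open MeasureTheory
open Polynomial (degreeLT)

variable {n : ℕ}

theorem integral_Icc_prod {ι : Type*} [Fintype ι] {a b : ι → ℝ} (h : ∀ i, a i ≤ b i)
    (g : ι → ℝ → ℝ) :
    ∫ y in Set.Icc a b, ∏ i, g i (y i) = ∏ i, ∫ x in (a i)..(b i), g i x := by
  rw [← Set.pi_univ_Icc, volume_pi, Measure.restrict_pi_pi, integral_fintype_prod_eq_prod]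
  refine Finset.prod_congr rfl fun i _ => ?_
  rw [intervalIntegral.integral_of_le (h i), integral_Icc_eq_integral_Ioc]

namespace Cell

theorem continuous_embed (f : Cell n) : Continuous f.embed := by
  refine continuous_pi fun i => ?_
  unfold embed
  split_ifs
  · exact continuous_apply _
  · exact continuous_const

/-- The integral over a face of a coefficient function. -/
def coeffIntegral (f : Cell n) : MvPolynomial (Fin n) ℝ →ₗ[ℝ] ℝ where
  toFun p := ∫ y in Set.Icc (fun i : f.dirs => f.lower i) (fun i : f.dirs => f.upper i),
    MvPolynomial.eval (f.embed y) p
  map_add' p q := by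
    simp only [map_add]
    exact integral_add
      ((MvPolynomial.continuous_eval p).comp f.continuous_embed).integrableOn_Icc
      ((MvPolynomial.continuous_eval q).comp f.continuous_embed).integrableOn_Icc
  map_smul' c p := by
    simp only [MvPolynomial.smul_eval, RingHom.id_apply, smul_eq_mul]
    exact integral_const_mul _ _

theorem integral_eq (f : Cell n) (w : PolyForm n) : f.integral w = f.coeffIntegral (w f.dirs) := rfl

/-- The one-dimensional factors of the integral over a face. -/
def integralDir (f : Cell n) (i : Fin n) : Polynomial ℝ →ₗ[ℝ] ℝ :=
  if i ∈ f.dirs then polyInt (f.lower i) (f.upper i) else Polynomial.leval (f.lower i)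

theorem coeffIntegral_eq_tensFun (f : Cell n) : f.coeffIntegral = tensFun f.integralDir := by
  refine hom_ext_tens fun p => ?_
  have h1 : ∀ y, MvPolynomial.eval (f.embed y) (tens p) =
      (∏ i : f.dirs, (p i).eval (y i)) * ∏ i ∈ f.dirsᶜ, (p i).eval (f.lower i) := by
    intro y
    rw [eval_tens, ← Finset.prod_mul_prod_compl f.dirs, ← Finset.prod_coe_sort]
    congr 1
    · exact Finset.prod_congr rfl fun i _ => by simp [embed]
    · refine Finset.prod_congr rfl fun i hi => ?_
      rw [Finset.mem_compl] at hi
      simp [embed, hi]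
  have h2 : f.coeffIntegral (tens p) =
      ∫ y in Set.Icc (fun i : f.dirs => f.lower i) (fun i : f.dirs => f.upper i),
        MvPolynomial.eval (f.embed y) (tens p) := rfl
  simp only [h2, h1]
  rw [integral_mul_const, integral_Icc_prod (ι := f.dirs) (fun i => f.le i.1) (fun i x => (p i.1).eval x),
    tensFun_tens, ← Finset.prod_mul_prod_compl f.dirs, ← Finset.prod_coe_sort f.dirs]
  refine congrArg₂ (· * ·) ?_ ?_
  · refine Finset.prod_congr rfl fun i _ => ?_
    rw [integralDir, if_pos i.2, polyInt_apply]
  · refine Finset.prod_congr rfl fun i hi => ?_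
    rw [Finset.mem_compl] at hi
    rw [integralDir, if_neg hi]
    rfl

/-- The one-dimensional factors of the degree of freedom on `f` with weight `x^β`. -/
def dofDir (f : Cell n) (β : Fin n →₀ ℕ) (i : Fin n) : Polynomial ℝ →ₗ[ℝ] ℝ :=
  if i ∈ f.dirs then moment (f.lower i) (f.upper i) (β i) else Polynomial.leval (f.lower i)

/-- In the coefficient of the volume form of `f`, only `dx_σ` with `σ` complementary to `τ` pairs
with `dx_τ`. So a degree of freedom is, up to sign, a product functional on one coefficient. -/
theorem integral_trace_wedge_formMonomial (f : Cell n) (u : PolyForm n) {β : Fin n →₀ ℕ}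
    {τ : Finset (Fin n)} (hβ : β.support ⊆ f.dirs) (hτ : τ ⊆ f.dirs) :
    f.integral (wedge (f.trace u) (formMonomial β τ)) =
      wedgeSign (f.dirs \ τ) τ * tensFun (f.dofDir β) (u (f.dirs \ τ)) := by
  have h1 : wedge (f.trace u) (formMonomial β τ) f.dirs =
      wedgeSign (f.dirs \ τ) τ • (f.trace u (f.dirs \ τ) * MvPolynomial.monomial β 1) := by
    rw [wedge, Finset.sum_eq_single (f.dirs \ τ)]
    · simp [formMonomial, Finset.sdiff_sdiff_eq_self hτ]
    · intro σ hσ hne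
      have : f.dirs \ σ ≠ τ := by
        rintro rfl
        exact hne (Finset.sdiff_sdiff_eq_self (Finset.mem_powerset.1 hσ)).symm
      simp [formMonomial, this]
    · intro h
      exact absurd (Finset.mem_powerset.2 Finset.sdiff_subset) h
  rw [integral_eq, h1, map_zsmul, zsmul_eq_mul, coeffIntegral_eq_tensFun,
    f.trace_of_subset _ Finset.sdiff_subset, tensOp_mul_monomial, tensFun_tensOp, tensFun_tensOp]
  congr 2
  refine congrArg _ (funext fun i => ?_)
  by_cases hi : i ∈ f.dirs
  · simp [integralDir, traceDir, dofDir, hi, moment]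
  · have : β i = 0 := Finsupp.notMem_support_iff.1 fun h => hi (hβ h)
    simp only [integralDir, traceDir, dofDir, if_neg hi, this]
    refine LinearMap.ext fun p => ?_
    simp

end Cell

theorem moment_comp_l2Proj {a b : ℝ} (hab : a < b) {r j : ℕ} (hj : j < r) :
    moment a b j ∘ₗ l2Proj a b r = moment a b j :=
  LinearMap.ext fun p => polyInt_l2Proj_mul hab p (X_pow_mem_degreeLT hj)

theorem moment_comp_interp {a b : ℝ} (hab : a < b) {r j : ℕ} (hr : 1 ≤ r) (hj : j + 1 < r) :
    moment a b j ∘ₗ interp a b r = moment a b j :=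
  LinearMap.ext fun p => polyInt_interp_mul hab hr p hj

/-- The bounds on `β` are exactly the moment orders kept by `l2Proj` (directions in `σ`) and by
`interp` (the other free directions). -/
theorem tensFun_dofDir_proj {T f : Cell n} (hT : ∀ i, T.lower i < T.upper i) {r : ℕ} (hr : 1 ≤ r)
    (hf : f.IsFaceOf T) (u : PolyForm n) {β : Fin n →₀ ℕ} {σ : Finset (Fin n)}
    (hσ : σ ⊆ f.dirs) (hβ : ∀ i ∈ σ, β i < r) (hβ' : ∀ i ∈ f.dirs \ σ, β i + 1 < r) :
    tensFun (f.dofDir β) (proj T r u σ) = tensFun (f.dofDir β) (u σ) := by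
  rw [proj_apply, tensFun_tensOp]
  refine congrArg (fun μ => tensFun μ (u σ)) (funext fun i => ?_)
  by_cases hi : i ∈ f.dirs
  · obtain ⟨h1, h2⟩ := hf.eq_of_mem_dirs hi
    simp only [Cell.dofDir, if_pos hi, projDir, h1, h2]
    split_ifs with hiσ
    · exact moment_comp_l2Proj (hT i) (hβ i hiσ)
    · exact moment_comp_interp (hT i) hr (hβ' i (Finset.mem_sdiff.2 ⟨hi, hiσ⟩))
  · have hiσ : i ∉ σ := fun h => hi (hσ h)
    simp only [Cell.dofDir, if_neg hi, projDir, if_neg hiσ]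
    exact eval_interp_endpoint (hT i) hr (hf.lower_eq i)

theorem wedge_add (u v v' : PolyForm n) : wedge u (v + v') = wedge u v + wedge u v' := by
  funext ρ
  simp [wedge, mul_add, Finset.sum_add_distrib]

theorem wedge_smul (c : ℝ) (u v : PolyForm n) : wedge u (c • v) = c • wedge u v := by
  funext ρ
  simp only [wedge, Pi.smul_apply, mul_smul_comm, Finset.smul_sum]
  exact Finset.sum_congr rfl fun _ _ => smul_comm _ _ _

theorem wedge_zero (u : PolyForm n) : wedge u 0 = 0 := by
  funext ρ
  simp [wedge]

theorem integral_proj {T f : Cell n} (hT : ∀ i, T.lower i < T.upper i) {r k : ℕ} (hr : 1 ≤ r)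
    (hf : f.IsFaceOf T) (u : PolyForm n) {v : PolyForm n}
    (hv : v ∈ Qminus f.dirs (r - 1) k) :
    f.integral (wedge (f.trace (proj T r u)) v) = f.integral (wedge (f.trace u) v) := by
  induction hv using Submodule.span_induction with
  | mem v hv =>
    obtain ⟨β, τ, ⟨hβ, hτ, -, hr'⟩, hc, rfl⟩ := hv
    rw [f.integral_trace_wedge_formMonomial _ hβ hτ, f.integral_trace_wedge_formMonomial _ hβ hτ,
      tensFun_dofDir_proj hT hr hf u Finset.sdiff_subset]
    · intro i _
      have := hr' i
      omega
    -- Here `i ∈ τ`, so `β i ≤ r - 1` and `β i ≠ r - 1`, one order less than in the other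
    -- directions. For `r = 1` there is no such `i`.
    · intro i hi
      rw [Finset.sdiff_sdiff_eq_self hτ] at hi
      rw [cdeg, Finset.card_eq_zero, Finset.filter_eq_empty_iff] at hc
      have h1 := hc hi
      have h2 := hr' i
      omega
  | zero => rw [wedge_zero, wedge_zero]
  | add v w _ _ hv hw =>
    simp only [Cell.integral_eq] at hv hw ⊢
    rw [wedge_add, wedge_add, Pi.add_apply, Pi.add_apply, map_add, map_add, hv, hw]
  | smul c v _ hv =>
    simp only [Cell.integral_eq] at hv ⊢
    rw [wedge_smul, wedge_smul, Pi.smul_apply, Pi.smul_apply, map_smul, map_smul, hv]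

theorem wedgeSign_ne_zero (σ τ : Finset (Fin n)) : ((wedgeSign σ τ : ℤ) : ℝ) ≠ 0 := by
  rw [wedgeSign]
  push_cast
  exact pow_ne_zero _ (by norm_num)

/-- The one-dimensional degrees of freedom in the direction `i` for the coefficient of `dx_σ`. -/
def dofSet (T : Cell n) (r : ℕ) (σ : Finset (Fin n)) (i : Fin n) : Set (Polynomial ℝ →ₗ[ℝ] ℝ) :=
  if i ∈ σ then moment (T.lower i) (T.upper i) '' {j | j < r}
  else {Polynomial.leval (T.lower i), Polynomial.leval (T.upper i)} ∪
    moment (T.lower i) (T.upper i) '' {j | j + 1 < r}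

theorem lcoeff_comp_projDir_mem_span {T : Cell n} (hT : ∀ i, T.lower i < T.upper i) (r : ℕ)
    (σ : Finset (Fin n)) (i : Fin n) (m : ℕ) :
    Polynomial.lcoeff ℝ m ∘ₗ projDir T r σ i ∈ Submodule.span ℝ (dofSet T r σ i) := by
  rw [projDir, dofSet]
  split_ifs
  · exact lcoeff_comp_l2Proj_mem_span (hT i) r m
  · exact lcoeff_comp_interp_mem_span (hT i) r m

/-- One univariate degree of freedom per direction determines a face: a moment selects the whole
interval, an evaluation selects that end point. The exponent is set to `0` in fixed directions to
keep the support of `β` within `f.dirs`. -/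
theorem exists_face_of_mem_dofSet {T : Cell n} (hT : ∀ i, T.lower i < T.upper i) {r : ℕ}
    {σ : Finset (Fin n)} {μ : Fin n → Polynomial ℝ →ₗ[ℝ] ℝ} (hμ : ∀ i, μ i ∈ dofSet T r σ i) :
    ∃ (f : Cell n) (β : Fin n →₀ ℕ), f.IsFaceOf T ∧ σ ⊆ f.dirs ∧ β.support ⊆ f.dirs ∧
      (∀ i ∈ σ, β i < r) ∧ (∀ i ∈ f.dirs \ σ, β i + 1 < r) ∧ μ = f.dofDir β := by
  have key : ∀ i, ∃ (lo hi : ℝ) (j : ℕ),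
      (lo = T.lower i ∧ hi = T.upper i ∧ (i ∈ σ → j < r) ∧ (i ∉ σ → j + 1 < r) ∧
        μ i = moment lo hi j) ∨
      ((lo = T.lower i ∧ hi = T.lower i ∨ lo = T.upper i ∧ hi = T.upper i) ∧ i ∉ σ ∧ j = 0 ∧
        μ i = Polynomial.leval lo) := by
    intro i
    have h := hμ i
    rw [dofSet] at h
    split_ifs at h with hi
    · obtain ⟨j, hj, h⟩ := h
      exact ⟨_, _, j, Or.inl ⟨rfl, rfl, fun _ => hj, fun h => absurd hi h, h.symm⟩⟩
    · rcases h with (h | h) | ⟨j, hj, h⟩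
      · exact ⟨_, _, 0, Or.inr ⟨Or.inl ⟨rfl, rfl⟩, hi, rfl, h⟩⟩
      · exact ⟨_, _, 0, Or.inr ⟨Or.inr ⟨rfl, rfl⟩, hi, rfl, h⟩⟩
      · exact ⟨_, _, j, Or.inl ⟨rfl, rfl, fun h => absurd h hi, fun _ => hj, h.symm⟩⟩
  choose lo hi β h using key
  let f : Cell n := ⟨lo, hi, fun i => by
    rcases h i with ⟨h1, h2, -⟩ | ⟨⟨h1, h2⟩ | ⟨h1, h2⟩, -⟩
    · rw [h1, h2]
      exact (hT i).le
    · rw [h1, h2]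
    · rw [h1, h2]⟩
  have hdir : ∀ i ∈ f.dirs, (i ∈ σ → β i < r) ∧ (i ∉ σ → β i + 1 < r) ∧
      μ i = moment (lo i) (hi i) (β i) := by
    intro i hif
    rw [Cell.mem_dirs] at hif
    change lo i < hi i at hif
    rcases h i with ⟨-, -, h⟩ | ⟨⟨h1, h2⟩ | ⟨h1, h2⟩, -⟩
    · exact h
    · rw [h1, h2] at hif
      exact absurd hif (lt_irrefl _)
    · rw [h1, h2] at hif
      exact absurd hif (lt_irrefl _)
  have hndir : ∀ i ∉ f.dirs, i ∉ σ ∧ β i = 0 ∧ μ i = Polynomial.leval (lo i) := by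
    intro i hif
    rw [Cell.mem_dirs] at hif
    change ¬ lo i < hi i at hif
    rcases h i with ⟨h1, h2, h⟩ | ⟨-, h⟩
    · rw [h1, h2] at hif
      exact absurd (hT i) hif
    · exact h
  refine ⟨f, Finsupp.equivFunOnFinite.symm β, fun i => ?_, fun i hi => ?_, fun i hi => ?_,
    fun i hi => ?_, fun i hi => ?_, funext fun i => ?_⟩
  · rcases h i with ⟨h1, h2, -⟩ | ⟨⟨h1, h2⟩ | ⟨h1, h2⟩, -⟩
    · exact Or.inl ⟨h1, h2⟩
    · exact Or.inr (Or.inl ⟨h1, h2⟩)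
    · exact Or.inr (Or.inr ⟨h1, h2⟩)
  · by_contra hif
    exact (hndir i hif).1 hi
  · by_contra hif
    exact Finsupp.mem_support_iff.1 hi (hndir i hif).2.1
  · by_cases hif : i ∈ f.dirs
    · exact (hdir i hif).1 hi
    · exact absurd hi (hndir i hif).1
  · rw [Finset.mem_sdiff] at hi
    exact (hdir i hi.1).2.1 hi.2
  · by_cases hif : i ∈ f.dirs
    · rw [Cell.dofDir, if_pos hif]
      exact (hdir i hif).2.2
    · rw [Cell.dofDir, if_neg hif]
      exact (hndir i hif).2.2

/-- Each coefficient of `proj (w - u)` is a product functional whose factors are combinations of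
univariate degrees of freedom; products of the latter are degrees of freedom on faces, and these
vanish at `w - u`. -/
theorem proj_congr_of_dofs {T : Cell n} (hT : ∀ i, T.lower i < T.upper i) {r k : ℕ}
    (hr : 1 ≤ r) {u w : PolyForm n} (hu : ∀ σ, σ.card ≠ k → u σ = 0)
    (hw : ∀ σ, σ.card ≠ k → w σ = 0)
    (h : ∀ f : Cell n, f.IsFaceOf T → k ≤ f.dirs.card →
      ∀ v ∈ Qminus f.dirs (r - 1) (f.dirs.card - k),
        f.integral (wedge (f.trace w) v) = f.integral (wedge (f.trace u) v)) :
    proj T r w = proj T r u := by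
  funext σ
  by_cases hσ : σ.card = k
  swap
  · rw [proj_apply, proj_apply, hu σ hσ, hw σ hσ]
  rw [← sub_eq_zero, proj_apply, proj_apply, ← map_sub]
  ext α
  rw [coeff_tensOp, MvPolynomial.coeff_zero]
  refine tensFun_eq_zero_of_mem_span _ (dofSet T r σ) (fun μ hμ => ?_) _
    fun i => lcoeff_comp_projDir_mem_span hT r σ i _
  obtain ⟨f, β, hf, hσf, hβ, hβσ, hβσ', rfl⟩ := exists_face_of_mem_dofSet hT hμ
  have hc := Finset.card_sdiff_add_card_eq_card hσf
  -- The test form `x^β dx_τ` with `τ = f.dirs \ σ` isolates the coefficient of `dx_σ`; the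
  -- conditions on `β` place it in `Q_{r-1}^-`.
  have := h f hf (by omega) (formMonomial β (f.dirs \ σ)) (Submodule.subset_span
    ⟨β, _, ⟨hβ, Finset.sdiff_subset, by omega, fun i => ?_⟩, ?_, rfl⟩)
  · rw [f.integral_trace_wedge_formMonomial _ hβ Finset.sdiff_subset,
      f.integral_trace_wedge_formMonomial _ hβ Finset.sdiff_subset,
      Finset.sdiff_sdiff_eq_self hσf] at this
    rw [map_sub, mul_left_cancel₀ (wedgeSign_ne_zero _ _) this, sub_self]
  · by_cases hif : i ∈ f.dirs
    · by_cases hi : i ∈ σ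
      · have := hβσ i hi
        omega
      · have := hβσ' i (Finset.mem_sdiff.2 ⟨hif, hi⟩)
        omega
    · rw [Finsupp.notMem_support_iff.1 fun h => hif (hβ h)]
      exact Nat.zero_le _
  · rw [cdeg, Finset.card_eq_zero, Finset.filter_eq_empty_iff]
    intro i hi
    have := hβσ' i hi
    omega

end CubicalForms

end

/-! ### The projection commutes with the exterior derivative -/

noncomputable section

namespace CubicalForms

open Polynomial (degreeLT)

variable {n : ℕ}

theorem d_apply (u : PolyForm n) (ρ : Finset (Fin n)) :
    d u ρ = ∑ i ∈ ρ, eps i (ρ.erase i) • MvPolynomial.pderiv i (u (ρ.erase i)) := rfl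

theorem kappa_apply (u : PolyForm n) (τ : Finset (Fin n)) :
    kappa u τ = ∑ i ∈ τᶜ, eps i τ • (MvPolynomial.X i * u (insert i τ)) := rfl

theorem eps_insert (i : Fin n) {j : Fin n} {σ : Finset (Fin n)} (hj : j ∉ σ) :
    eps i (insert j σ) = if j < i then -eps i σ else eps i σ := by
  rw [eps, eps, Finset.filter_insert]
  split_ifs with h
  · rw [Finset.card_insert_of_notMem (by simp [hj]), pow_succ]
    ring
  · rfl

/-- The anticommutation `dx_i ∧ dx_j = -dx_j ∧ dx_i`: exactly one of the two signs changes when the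
other index is removed first. -/
theorem eps_mul_eps_add {i j : Fin n} (hij : i ≠ j) {ρ : Finset (Fin n)} (hi : i ∈ ρ)
    (hj : j ∈ ρ) :
    eps i (ρ.erase i) * eps j ((ρ.erase i).erase j) +
      eps j (ρ.erase j) * eps i ((ρ.erase j).erase i) = 0 := by
  have h1 : ρ.erase i = insert j ((ρ.erase i).erase j) :=
    (Finset.insert_erase (Finset.mem_erase.2 ⟨hij.symm, hj⟩)).symm
  have h2 : ρ.erase j = insert i ((ρ.erase i).erase j) := by
    rw [Finset.erase_right_comm]
    exact (Finset.insert_erase (Finset.mem_erase.2 ⟨hij, hi⟩)).symm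
  rw [Finset.erase_right_comm (a := j)]
  nth_rw 1 [h1]
  rw [h2, eps_insert i (by simp), eps_insert j (by simp)]
  rcases lt_or_gt_of_ne hij with h | h
  · rw [if_neg h.not_gt, if_pos h]
    ring
  · rw [if_pos h, if_neg h.not_gt]
    ring

theorem pderiv_pderiv_comm (i j : Fin n) (p : MvPolynomial (Fin n) ℝ) :
    MvPolynomial.pderiv i (MvPolynomial.pderiv j p) =
      MvPolynomial.pderiv j (MvPolynomial.pderiv i p) := by
  simp only [pderiv_eq_tensOp, tensOp_tensOp]
  congr 2
  funext l
  split_ifs <;> simp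

theorem d_d (u : PolyForm n) : d (d u) = 0 := by
  funext ρ
  rw [Pi.zero_apply, d_apply]
  have h1 : ∀ i ∈ ρ, eps i (ρ.erase i) • MvPolynomial.pderiv i (d u (ρ.erase i)) =
      ∑ j ∈ ρ.erase i, (eps i (ρ.erase i) * eps j ((ρ.erase i).erase j)) •
        MvPolynomial.pderiv i (MvPolynomial.pderiv j (u ((ρ.erase i).erase j))) := by
    intro i _
    rw [d_apply, map_sum, Finset.smul_sum]
    refine Finset.sum_congr rfl fun j _ => ?_
    rw [map_zsmul, mul_smul]
  rw [Finset.sum_congr rfl h1, Finset.sum_sigma']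
  -- The terms for `(i, j)` and `(j, i)` cancel: equal second derivatives, opposite signs.
  refine Finset.sum_involution (fun p _ => ⟨p.2, p.1⟩) ?_ ?_ ?_ ?_
  · rintro ⟨i, j⟩ hp
    simp only [Finset.mem_sigma, Finset.mem_erase] at hp
    obtain ⟨hi, hji, hj⟩ := hp
    simp only
    rw [pderiv_pderiv_comm, Finset.erase_right_comm (a := j), ← add_smul,
      Finset.erase_right_comm (a := i)]
    have := eps_mul_eps_add (Ne.symm hji) hi hj
    rw [Finset.erase_right_comm (a := i)] at this
    rw [this, zero_smul]
  · rintro ⟨i, j⟩ hp _ h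
    simp only [Finset.mem_sigma, Finset.mem_erase] at hp
    simp only [Sigma.mk.injEq, heq_eq_eq] at h
    exact hp.2.1 h.1
  · rintro ⟨i, j⟩ hp
    simp only [Finset.mem_sigma, Finset.mem_erase] at hp ⊢
    exact ⟨hp.2.2, Ne.symm hp.2.1, hp.1⟩
  · rintro ⟨i, j⟩ _
    rfl

/-- In the term with `∂_i`, the index `i` is absent from `ρ.erase i` and present in `ρ`, so the
factor in direction `i` changes from `interp` to `l2Proj`, as in `derivative_interp`. The other
factors are the same for both index sets. -/
theorem d_proj (T : Cell n) (r : ℕ) (u : PolyForm n) : d (proj T r u) = proj T r (d u) := by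
  funext ρ
  rw [proj_apply, d_apply, d_apply, map_sum]
  refine Finset.sum_congr rfl fun i hi => ?_
  rw [map_zsmul, proj_apply, pderiv_eq_tensOp, pderiv_eq_tensOp, tensOp_tensOp, tensOp_tensOp]
  congr 3
  funext j
  by_cases h : j = i
  · subst h
    simp only [projDir, if_pos hi, Finset.notMem_erase, if_false, if_true]
    exact LinearMap.ext fun p => derivative_interp _ _ _ p
  · simp only [projDir, Finset.mem_erase, ne_eq, h, not_false_eq_true, true_and, if_false,
      LinearMap.id_comp, LinearMap.comp_id]

theorem d_mem_boxDeg {δ : Fin n → ℕ} {u : PolyForm n} (hu : ∀ σ, u σ ∈ boxDeg δ)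
    (ρ : Finset (Fin n)) : d u ρ ∈ boxDeg δ := by
  rw [d_apply]
  refine Submodule.sum_mem _ fun i _ => zsmul_mem ?_ _
  rw [pderiv_eq_tensOp]
  refine tensOp_mem_boxDeg (fun j p hp => ?_) (hu _)
  split_ifs
  · rw [Polynomial.mem_degreeLT] at hp ⊢
    exact Polynomial.degree_derivative_le.trans_lt hp
  · exact hp

theorem kappa_mem_boxDeg {N : ℕ} {u : PolyForm n} (hu : ∀ σ, u σ ∈ boxDeg fun _ => N)
    (τ : Finset (Fin n)) : kappa u τ ∈ boxDeg fun _ => N + 1 := by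
  rw [kappa_apply]
  refine Submodule.sum_mem _ fun i _ => zsmul_mem ?_ _
  rw [mul_comm, MvPolynomial.X, tensOp_mul_monomial]
  refine tensOp_mem_boxDeg (fun j p hp => ?_) (hu _)
  rw [LinearMap.mulRight_apply]
  rcases eq_or_ne p 0 with rfl | h0
  · simp
  rw [Polynomial.mem_degreeLT] at hp ⊢
  rw [Polynomial.degree_mul, Polynomial.degree_X_pow]
  rw [Polynomial.degree_eq_natDegree h0] at hp ⊢
  have h1 : p.natDegree < N := by exact_mod_cast hp
  have h2 : (Finsupp.single i 1 : Fin n →₀ ℕ) j ≤ 1 := by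
    rw [Finsupp.single_apply]
    split_ifs <;> omega
  exact_mod_cast (by omega : p.natDegree + (Finsupp.single i 1 : Fin n →₀ ℕ) j < N + 1)

theorem d_kappa_apply_eq_zero {k : ℕ} {u : PolyForm n} (hu : ∀ σ, σ.card ≠ k → u σ = 0)
    {ρ : Finset (Fin n)} (hρ : ρ.card ≠ k) : d (kappa u) ρ = 0 := by
  rw [d_apply]
  refine Finset.sum_eq_zero fun i hi => ?_
  have : kappa u (ρ.erase i) = 0 := by
    rw [kappa_apply]
    refine Finset.sum_eq_zero fun j hj => ?_
    rw [hu, mul_zero, smul_zero]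
    rwa [Finset.card_insert_of_notMem (Finset.mem_compl.1 hj), Finset.card_erase_add_one hi]
  rw [this, map_zero, smul_zero]

theorem Bspace_le {r k : ℕ} {u : PolyForm n} (hu : u ∈ Bspace n r k) (σ : Finset (Fin n)) :
    u σ ∈ boxDeg (fun _ => r + 1) ∧ (σ.card ≠ k → u σ = 0) := by
  induction hu using Submodule.span_induction with
  | mem u hu =>
    obtain ⟨α, τ, ⟨-, -, hk, hr⟩, hc, rfl⟩ := hu
    by_cases h : σ = τ
    · subst h
      simp only [formMonomial, Pi.single_eq_same]
      exact ⟨monomial_mem_boxDeg fun i => Nat.lt_succ_of_le (hr i), fun h => absurd hk h⟩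
    · simp [formMonomial, h]
  | zero => simp
  | add u v _ _ hu hv =>
    exact ⟨Submodule.add_mem _ hu.1 hv.1, fun h => by
      rw [Pi.add_apply, hu.2 h, hv.2 h, add_zero]⟩
  | smul c u _ hu =>
    exact ⟨Submodule.smul_mem _ _ hu.1, fun h => by
      rw [Pi.smul_apply, hu.2 h, smul_zero]⟩

theorem Qtilde_apply_eq_zero {r k : ℕ} {u : PolyForm n} (hu : u ∈ Qtilde n r k)
    {σ : Finset (Fin n)} (hσ : σ.card ≠ k) : u σ = 0 := by
  obtain ⟨q, hq, _, ⟨b, hb, rfl⟩, rfl⟩ := Submodule.mem_sup.1 hu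
  rw [Pi.add_apply, (Qminus_le hq σ).2 hσ, LinearMap.comp_apply,
    d_kappa_apply_eq_zero (fun σ => (Bspace_le hb σ).2) hσ, add_zero]

/-- `κ` raises each partial degree by at most one and `d` raises none. Such a uniform bound places
all shape functions in one finite-dimensional space. -/
theorem Qtilde_mem_boxDeg {r k : ℕ} {u : PolyForm n} (hu : u ∈ Qtilde n r k)
    (σ : Finset (Fin n)) : u σ ∈ boxDeg fun _ => r + 2 := by
  obtain ⟨q, hq, _, ⟨b, hb, rfl⟩, rfl⟩ := Submodule.mem_sup.1 hu
  refine Submodule.add_mem _ (boxDeg_mono (fun i => ?_) (Qminus_le hq σ).1)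
    (d_mem_boxDeg (kappa_mem_boxDeg fun σ => (Bspace_le hb σ).1) σ)
  rw [qminusDeg]
  split_ifs <;> omega

/-- The part in `Q_r^- Λ^k` cancels; for the rest, `d (proj (dκb)) = proj (d (dκb)) = 0`. -/
theorem d_sub_proj {T : Cell n} (hT : ∀ i, T.lower i < T.upper i) {r k : ℕ} {u : PolyForm n}
    (hu : u ∈ Qtilde n r k) : d (u - proj T r u) = 0 := by
  obtain ⟨q, hq, _, ⟨b, hb, rfl⟩, rfl⟩ := Submodule.mem_sup.1 hu
  rw [map_add, proj_of_mem_Qminus hT hq, add_sub_add_left_eq_sub, map_sub, d_proj,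
    LinearMap.comp_apply, d_d, map_zero, sub_zero]

end CubicalForms

end

/-! ### The L² bound by scaling to the unit cube -/

noncomputable section

namespace CubicalForms

open MeasureTheory
open Polynomial (degreeLT)

variable {n : ℕ}

namespace Cell

/-- The integral of a coefficient function over a cell. -/
def boxIntegral (T : Cell n) : MvPolynomial (Fin n) ℝ →ₗ[ℝ] ℝ where
  toFun p := ∫ x in T.carrier, MvPolynomial.eval x p
  map_add' p q := by
    simp only [map_add]
    exact integral_add (MvPolynomial.continuous_eval p).integrableOn_Icc
      (MvPolynomial.continuous_eval q).integrableOn_Icc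
  map_smul' c p := by
    simp only [MvPolynomial.smul_eval, RingHom.id_apply, smul_eq_mul]
    exact integral_const_mul _ _

theorem boxIntegral_apply (T : Cell n) (p : MvPolynomial (Fin n) ℝ) :
    T.boxIntegral p = ∫ x in T.carrier, MvPolynomial.eval x p := rfl

theorem boxIntegral_eq_tensFun (T : Cell n) :
    T.boxIntegral = tensFun fun i => polyInt (T.lower i) (T.upper i) := by
  refine hom_ext_tens fun p => ?_
  simp only [boxIntegral_apply, eval_tens, tensFun_tens, polyInt_apply]
  exact integral_Icc_prod T.le fun i x => (p i).eval x

/-- The unit cube. -/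
def unit (n : ℕ) : Cell n := ⟨0, 1, fun _ => zero_le_one⟩

/-- The pullback of coefficient functions on `T` to the unit cube. -/
def pullback (T : Cell n) : MvPolynomial (Fin n) ℝ →ₗ[ℝ] MvPolynomial (Fin n) ℝ :=
  tensOp fun i => affineComp (T.lower i) (T.upper i - T.lower i)

theorem eval_pullback (T : Cell n) (p : MvPolynomial (Fin n) ℝ) (x : Fin n → ℝ) :
    MvPolynomial.eval x (T.pullback p) =
      MvPolynomial.eval (fun i => (T.upper i - T.lower i) * x i + T.lower i) p := by
  have : (MvPolynomial.aeval x).toLinearMap ∘ₗ T.pullback = (MvPolynomial.aeval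
      (fun i => (T.upper i - T.lower i) * x i + T.lower i)).toLinearMap := by
    refine hom_ext_tens fun p => ?_
    simp [pullback, MvPolynomial.aeval_eq_eval, eval_tens, eval_affineComp]
  simpa [MvPolynomial.aeval_eq_eval] using LinearMap.congr_fun this p

theorem pullback_mul (T : Cell n) (p q : MvPolynomial (Fin n) ℝ) :
    T.pullback (p * q) = T.pullback p * T.pullback q :=
  MvPolynomial.funext fun x => by simp [eval_pullback]

theorem boxIntegral_eq (T : Cell n) (p : MvPolynomial (Fin n) ℝ) :
    T.boxIntegral p =
      (∏ i, (T.upper i - T.lower i)) * (unit n).boxIntegral (T.pullback p) := by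
  have : T.boxIntegral =
      (∏ i, (T.upper i - T.lower i)) • ((unit n).boxIntegral ∘ₗ T.pullback) := by
    refine hom_ext_tens fun p => ?_
    simp only [boxIntegral_eq_tensFun, pullback, LinearMap.smul_apply, LinearMap.comp_apply,
      tensOp_tens, tensFun_tens, smul_eq_mul, ← Finset.prod_mul_distrib]
    exact Finset.prod_congr rfl fun i _ => (polyInt_affineComp _ _ _).symm
  exact LinearMap.congr_fun this p

/-- Coefficients are pulled back as functions, without the side length factors of `dx_σ`. This is
enough because the projection does not mix different `σ`, and it keeps the bound independent of the
shape of `T`. -/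
theorem tensOp_projDir_pullback {T : Cell n} (hT : ∀ i, T.lower i < T.upper i) (r : ℕ)
    (σ : Finset (Fin n)) (p : MvPolynomial (Fin n) ℝ) :
    tensOp (projDir (unit n) r σ) (T.pullback p) = T.pullback (tensOp (projDir T r σ) p) := by
  rw [pullback, tensOp_tensOp, tensOp_tensOp]
  congr 2
  funext i
  refine LinearMap.ext fun p => ?_
  simp only [projDir, LinearMap.comp_apply]
  split_ifs
  · exact l2Proj_affineComp (hT i) p
  · exact interp_affineComp (hT i) p

end Cell

theorem finite_boxDeg (δ : Fin n → ℕ) : FiniteDimensional ℝ (boxDeg δ) := by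
  rw [boxDeg_eq_span]
  refine FiniteDimensional.span_of_finite ℝ (Set.Finite.image _ ?_)
  exact (Set.Finite.pi' fun i => Set.finite_lt_nat (δ i)).preimage DFunLike.coe_injective.injOn

theorem memLp_restrict_of_isCompact {s : Set (Fin n → ℝ)} (hs : IsCompact s)
    {g : (Fin n → ℝ) → ℝ} (hg : Continuous g) : MemLp g 2 (volume.restrict s) := by
  have : IsFiniteMeasure (volume.restrict s) :=
    isFiniteMeasure_restrict.2 hs.measure_lt_top.ne
  obtain ⟨C, hC⟩ := hs.exists_bound_of_continuousOn hg.continuousOn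
  exact MemLp.of_bound hg.aestronglyMeasurable C
    (ae_restrict_of_forall_mem hs.measurableSet hC)

theorem memLp_unit (p : MvPolynomial (Fin n) ℝ) :
    MemLp (fun x => MvPolynomial.eval x p) 2 (volume.restrict (Cell.unit n).carrier) :=
  memLp_restrict_of_isCompact isCompact_Icc (MvPolynomial.continuous_eval p)

/-- A coefficient function as an element of `L²` of the unit cube. -/
def unitLp (n : ℕ) :
    MvPolynomial (Fin n) ℝ →ₗ[ℝ] Lp ℝ 2 (volume.restrict (Cell.unit n).carrier) where
  toFun p := (memLp_unit p).toLp _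
  map_add' p q := by
    rw [← MemLp.toLp_add]
    congr 1
    funext x
    simp
  map_smul' c p := by
    rw [RingHom.id_apply, ← MemLp.toLp_const_smul]
    congr 1
    funext x
    simp

theorem norm_unitLp_sq (p : MvPolynomial (Fin n) ℝ) :
    ‖unitLp n p‖ ^ 2 = (Cell.unit n).boxIntegral (p * p) := by
  rw [← real_inner_self_eq_norm_sq, L2.inner_def, Cell.boxIntegral_apply]
  refine integral_congr_ae ?_
  filter_upwards [(memLp_unit p).coeFn_toLp] with x hx
  change inner ℝ ((memLp_unit p).toLp _ x) ((memLp_unit p).toLp _ x) = _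
  rw [hx]
  simp [sq]

/-- A polynomial vanishing almost everywhere on the cube vanishes on the open cube by continuity,
and a product of infinite sets determines a polynomial. -/
theorem unitLp_injective : Function.Injective (unitLp n) := by
  rw [injective_iff_map_eq_zero]
  intro p hp
  have h1 : (fun x => MvPolynomial.eval x p) =ᵐ[volume.restrict (Cell.unit n).carrier]
      fun _ => (0 : ℝ) := by
    have h2 := (memLp_unit p).coeFn_toLp
    have h3 : (memLp_unit p).toLp _ = 0 := hp
    rw [h3] at h2
    exact h2.symm.trans (Lp.coeFn_zero _ _ _)
  have h4 : Set.pi Set.univ (fun _ : Fin n => Set.Ioo (0 : ℝ) 1) ⊆ (Cell.unit n).carrier := by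
    intro x hx
    exact ⟨fun i => (hx i trivial).1.le, fun i => (hx i trivial).2.le⟩
  have h5 := Measure.eqOn_open_of_ae_eq (ae_restrict_of_ae_restrict_of_subset h4 h1)
    (isOpen_set_pi Set.finite_univ fun _ _ => isOpen_Ioo)
    (MvPolynomial.continuous_eval p).continuousOn continuousOn_const
  refine MvPolynomial.funext_set (fun _ => Set.Ioo (0 : ℝ) 1)
    (fun _ => Set.Ioo_infinite one_pos) fun x hx => ?_
  rw [map_zero]
  exact h5 hx

/-- Linear maps on a finite-dimensional normed space are bounded; the norm comes from embedding
`boxDeg δ` in L² of the cube. -/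
theorem exists_unit_bound (δ : Fin n → ℕ)
    (A : MvPolynomial (Fin n) ℝ →ₗ[ℝ] MvPolynomial (Fin n) ℝ) :
    ∃ C : ℝ, ∀ p ∈ boxDeg δ, (Cell.unit n).boxIntegral (A p * A p) ≤
      C * (Cell.unit n).boxIntegral (p * p) := by
  have := finite_boxDeg δ
  let f := unitLp n ∘ₗ (boxDeg δ).subtype
  have hf : Function.Injective f := unitLp_injective.comp Subtype.val_injective
  let e := LinearEquiv.ofInjective f hf
  let g := (unitLp n ∘ₗ A ∘ₗ (boxDeg δ).subtype ∘ₗ e.symm.toLinearMap).toContinuousLinearMap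
  refine ⟨‖g‖ ^ 2, fun p hp => ?_⟩
  have h1 := g.le_opNorm (e ⟨p, hp⟩)
  have h2 : g (e ⟨p, hp⟩) = unitLp n (A p) := by simp [g]
  have h3 : ‖e ⟨p, hp⟩‖ = ‖unitLp n p‖ := rfl
  rw [h2, h3] at h1
  rw [← norm_unitLp_sq, ← norm_unitLp_sq, ← mul_pow]
  gcongr

theorem exists_proj_bound (n r N : ℕ) :
    ∃ C : ℝ, 0 < C ∧ ∀ T : Cell n, (∀ i, T.lower i < T.upper i) → ∀ u : PolyForm n,
      (∀ σ, u σ ∈ boxDeg fun _ => N) → ∀ σ,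
        T.boxIntegral (proj T r u σ * proj T r u σ) ≤ C * T.boxIntegral (u σ * u σ) := by
  choose C hC using fun σ : Finset (Fin n) =>
    exists_unit_bound (fun _ => N) (tensOp (projDir (Cell.unit n) r σ))
  -- One positive constant that dominates the constants of all `σ`.
  refine ⟨1 + ∑ σ, |C σ|, by positivity, fun T hT u hu σ => ?_⟩
  have h1 : T.pullback (u σ) ∈ boxDeg fun _ => N :=
    tensOp_mem_boxDeg (fun i p hp => affineComp_mem_degreeLT _ _ hp) (hu σ)
  have h2 := hC σ _ h1
  rw [Cell.tensOp_projDir_pullback hT, ← Cell.pullback_mul, ← Cell.pullback_mul] at h2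
  have h3 : 0 ≤ (Cell.unit n).boxIntegral (T.pullback (u σ * u σ)) := by
    rw [Cell.pullback_mul, ← norm_unitLp_sq]
    positivity
  have h4 : C σ ≤ 1 + ∑ σ, |C σ| := by
    have := Finset.single_le_sum (fun σ _ => abs_nonneg (C σ)) (Finset.mem_univ σ)
    have := le_abs_self (C σ)
    linarith
  have h5 : 0 ≤ ∏ i, (T.upper i - T.lower i) :=
    Finset.prod_nonneg fun i _ => (sub_pos.2 (hT i)).le
  rw [T.boxIntegral_eq, T.boxIntegral_eq, mul_left_comm]
  exact mul_le_mul_of_nonneg_left (h2.trans (mul_le_mul_of_nonneg_right h4 h3)) h5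

end CubicalForms

end

/-! ### Geometry of the mesh and norms of piecewise forms -/

noncomputable section

namespace CubicalForms

open MeasureTheory

variable {n : ℕ}

namespace Cell

theorem interior_carrier (T : Cell n) :
    interior T.carrier = Set.pi Set.univ fun i => Set.Ioo (T.lower i) (T.upper i) := by
  rw [carrier, ← Set.pi_univ_Icc, interior_pi_set Set.finite_univ]
  simp

theorem mem_interior_carrier {T : Cell n} {x : Fin n → ℝ} :
    x ∈ interior T.carrier ↔ ∀ i, x i ∈ Set.Ioo (T.lower i) (T.upper i) := by
  rw [interior_carrier, Set.mem_univ_pi]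

theorem interior_carrier_ae_eq (T : Cell n) : interior T.carrier =ᵐ[volume] T.carrier := by
  rw [interior_carrier]
  exact Measure.univ_pi_Ioo_ae_eq_Icc

theorem IsFaceOf.eq_of_mem_Ioo {f T : Cell n} (h : f.IsFaceOf T) {x : Fin n → ℝ}
    (hx : x ∈ f.carrier) {i : Fin n} (hi : x i ∈ Set.Ioo (T.lower i) (T.upper i)) :
    f.lower i = T.lower i ∧ f.upper i = T.upper i := by
  have h1 := hx.1 i
  have h2 := hx.2 i
  rcases h i with h | h | h
  · exact h
  · exact absurd (h2.trans_eq h.2) (not_le.2 hi.1)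
  · exact absurd (h.1.symm.trans_le h1) (not_le.2 hi.2)

end Cell

namespace CubicalMesh

variable {Ω : Set (Fin n → ℝ)} (𝒯 : CubicalMesh Ω)

/-- A face containing an interior point of `T` has the full interval of `T` in every coordinate. The
common face is thus both `T` and `T'`. -/
theorem eq_of_mem_interior {T T' : Cell n} (hT : T ∈ 𝒯.cells) (hT' : T' ∈ 𝒯.cells)
    {x : Fin n → ℝ} (hx : x ∈ interior T.carrier) (hx' : x ∈ interior T'.carrier) : T = T' := by
  by_contra hne
  have hm : x ∈ T.carrier ∩ T'.carrier := ⟨_root_.interior_subset hx, _root_.interior_subset hx'⟩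
  obtain ⟨f, hf, hf', hc⟩ := 𝒯.face_to_face T hT T' hT' hne ⟨x, hm⟩
  rw [← hc] at hm
  rw [Cell.mem_interior_carrier] at hx hx'
  refine hne (Cell.ext (funext fun i => ?_) (funext fun i => ?_))
  · rw [← (hf.eq_of_mem_Ioo hm (hx i)).1, (hf'.eq_of_mem_Ioo hm (hx' i)).1]
  · rw [← (hf.eq_of_mem_Ioo hm (hx i)).2, (hf'.eq_of_mem_Ioo hm (hx' i)).2]

theorem restrict_restrict_interior {T : Cell n} (hT : T ∈ 𝒯.cells) :
    (volume.restrict Ω).restrict (interior T.carrier) = volume.restrict T.carrier := by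
  rw [Measure.restrict_restrict isOpen_interior.measurableSet,
    Set.inter_eq_left.2 (𝒯.interior_subset T hT)]
  exact Measure.restrict_congr_set T.interior_carrier_ae_eq

theorem integral_sum_indicator {G : 𝒯.cells → (Fin n → ℝ) → ℝ} (hG : ∀ T, Continuous (G T)) :
    ∫ x in Ω, ∑ T : 𝒯.cells, Set.indicator (interior T.1.carrier) (G T) x =
      ∑ T : 𝒯.cells, ∫ x in T.1.carrier, G T x := by
  rw [integral_finsetSum]
  · refine Finset.sum_congr rfl fun T _ => ?_
    rw [integral_indicator isOpen_interior.measurableSet, 𝒯.restrict_restrict_interior T.2]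
  · intro T _
    rw [integrable_indicator_iff isOpen_interior.measurableSet, IntegrableOn,
      𝒯.restrict_restrict_interior T.2]
    exact (hG T).integrableOn_Icc

theorem memLp_toForm (u : 𝒯.Broken) (σ : Finset (Fin n)) :
    MemLp (fun x => 𝒯.toForm u x σ) 2 (volume.restrict Ω) := by
  unfold toForm
  refine memLp_finsetSum _ fun T _ => ?_
  rw [memLp_indicator_iff_restrict isOpen_interior.measurableSet,
    𝒯.restrict_restrict_interior T.2]
  exact memLp_restrict_of_isCompact isCompact_Icc (MvPolynomial.continuous_eval _)

/-- The interiors of the cells are disjoint, so squaring the sum over cells produces no cross terms.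
-/
theorem sum_toForm_sq (u : 𝒯.Broken) (x : Fin n → ℝ) :
    ∑ σ, 𝒯.toForm u x σ ^ 2 = ∑ T : 𝒯.cells, Set.indicator (interior T.1.carrier)
      (fun y => ∑ σ, MvPolynomial.eval y (u T σ * u T σ)) x := by
  by_cases h : ∃ T : 𝒯.cells, x ∈ interior T.1.carrier
  · obtain ⟨T, hT⟩ := h
    have hne : ∀ T' : 𝒯.cells, T' ≠ T → x ∉ interior T'.1.carrier := fun T' hne hT' =>
      hne (Subtype.ext (𝒯.eq_of_mem_interior T'.2 T.2 hT' hT))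
    rw [Finset.sum_eq_single T (fun T' _ h => Set.indicator_of_notMem (hne T' h) _) (by simp),
      Set.indicator_of_mem hT]
    refine Finset.sum_congr rfl fun σ _ => ?_
    rw [toForm, Finset.sum_eq_single T (fun T' _ h => Set.indicator_of_notMem (hne T' h) _)
      (by simp), Set.indicator_of_mem hT, map_mul, sq]
  · push Not at h
    rw [Finset.sum_eq_zero fun T _ => Set.indicator_of_notMem (h T) _]
    refine Finset.sum_eq_zero fun σ _ => ?_
    rw [toForm, Finset.sum_eq_zero fun T _ => Set.indicator_of_notMem (h T) _]
    simp

theorem l2Norm_toForm (u : 𝒯.Broken) :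
    l2Norm Ω (𝒯.toForm u) =
      Real.sqrt (∑ T : 𝒯.cells, ∑ σ, T.1.boxIntegral (u T σ * u T σ)) := by
  rw [l2Norm]
  simp only [sum_toForm_sq]
  rw [𝒯.integral_sum_indicator fun T =>
    continuous_finsetSum _ fun σ _ => MvPolynomial.continuous_eval _]
  congr 1
  refine Finset.sum_congr rfl fun T _ => ?_
  exact integral_finsetSum _ fun σ _ => (MvPolynomial.continuous_eval _).integrableOn_Icc

/-- Move from `x` in direction `i` to points with coordinate in `s`; near `x` they stay in `Ω`,
hence in cells. As there are finitely many closed cells, one of them contains such points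
accumulating at `x`, and so `x` itself. -/
theorem exists_mem_cell (hΩ : IsOpen Ω) {x : Fin n → ℝ} (hx : x ∈ Ω) (i : Fin n) {s : Set ℝ}
    (hs : x i ∈ closure s) :
    ∃ T ∈ 𝒯.cells, x ∈ T.carrier ∧ ∃ z ∈ T.carrier, z i ∈ s := by
  have h1 : x ∈ closure {z : Fin n → ℝ | z i ∈ s} := by
    have := map_mem_closure (f := Function.update x i) (t := {z | z i ∈ s})
      (continuous_const.update i continuous_id) hs fun t ht => by simpa using ht
    rwa [Function.update_eq_self] at this
  have h2 : Ω ∩ {z | z i ∈ s} ⊆ ⋃ T ∈ 𝒯.cells, T.carrier ∩ {z | z i ∈ s} := by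
    rintro z ⟨hz, hzs⟩
    have h3 : z ∈ ⋃ T ∈ 𝒯.cells, T.carrier := 𝒯.closure_eq ▸ subset_closure hz
    simp only [Set.mem_iUnion, exists_prop] at h3 ⊢
    obtain ⟨T, hT, hzT⟩ := h3
    exact ⟨T, hT, hzT, hzs⟩
  have h4 := closure_mono h2 (hΩ.inter_closure ⟨hx, h1⟩)
  rw [Finset.closure_biUnion] at h4
  simp only [Set.mem_iUnion, exists_prop] at h4
  obtain ⟨T, hT, hxT⟩ := h4
  obtain ⟨z, hz, hzs⟩ := closure_nonempty_iff.1 ⟨x, hxT⟩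
  have hcl : IsClosed T.carrier := isClosed_Icc
  exact ⟨T, hT, hcl.closure_subset_iff.2 Set.inter_subset_left hxT, z, hz, hzs⟩

/-- The common face contains `x`, so it is free in every direction `j ≠ i`. If it were free in
direction `i` too, both cells would have the same interval there, contrary to `z`. -/
theorem exists_common_facet {T T' : Cell n} (hT : T ∈ 𝒯.cells) (hT' : T' ∈ 𝒯.cells)
    {x z : Fin n → ℝ} {i : Fin n} (hx : x ∈ T.carrier) (hx' : x ∈ T'.carrier)
    (hxj : ∀ j ≠ i, x j ∈ Set.Ioo (T.lower j) (T.upper j)) (hz : z ∈ T'.carrier)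
    (hzi : z i ∉ Set.Icc (T.lower i) (T.upper i)) :
    (∀ j ≠ i, T'.lower j = T.lower j ∧ T'.upper j = T.upper j) ∧
      (x i = T'.lower i ∨ x i = T'.upper i) ∧
      ∃ f : Cell n, f.IsFaceOf T ∧ f.IsFaceOf T' ∧ ∀ j, (j ∈ f.dirs ↔ j ≠ i) ∧
        (j ∉ f.dirs → x j = f.lower j) := by
  have hne : T ≠ T' := by
    rintro rfl
    exact hzi ⟨hz.1 i, hz.2 i⟩
  obtain ⟨f, hf, hf', hc⟩ := 𝒯.face_to_face T hT T' hT' hne ⟨x, hx, hx'⟩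
  have hxf : x ∈ f.carrier := hc ▸ ⟨hx, hx'⟩
  have h1 : ∀ j ≠ i, f.lower j = T.lower j ∧ f.upper j = T.upper j := fun j hj =>
    hf.eq_of_mem_Ioo hxf (hxj j hj)
  have h2 : ∀ j ≠ i, j ∈ f.dirs := fun j hj => by
    rw [Cell.mem_dirs, (h1 j hj).1, (h1 j hj).2]
    exact 𝒯.nondegenerate T hT j
  have h3 : i ∉ f.dirs := fun hi => by
    have h4 := hf.eq_of_mem_dirs hi
    have h5 := hf'.eq_of_mem_dirs hi
    refine hzi ⟨?_, ?_⟩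
    · rw [← h4.1, h5.1]
      exact hz.1 i
    · rw [← h4.2, h5.2]
      exact hz.2 i
  have h4 : x i = f.lower i := by
    rw [Cell.mem_dirs] at h3
    exact le_antisymm ((hxf.2 i).trans (not_lt.1 h3)) (hxf.1 i)
  refine ⟨fun j hj => ?_, h4 ▸ hf'.lower_eq i, f, hf, hf', fun j => ⟨⟨?_, h2 j⟩, fun hj => ?_⟩⟩
  · rw [← (h1 j hj).1, ← (h1 j hj).2]
    have := hf'.eq_of_mem_dirs (h2 j hj)
    exact ⟨this.1.symm, this.2.symm⟩
  · rintro hj rfl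
    exact h3 hj
  · have : j = i := by
      by_contra h
      exact hj (h2 j h)
    rw [this, h4]

end CubicalMesh

theorem Cell.eval_trace (f : Cell n) (u : PolyForm n) {σ : Finset (Fin n)} (hσ : σ ⊆ f.dirs)
    {x : Fin n → ℝ} (hx : ∀ i ∉ f.dirs, x i = f.lower i) :
    MvPolynomial.eval x (f.trace u σ) = MvPolynomial.eval x (u σ) := by
  rw [trace, if_pos hσ, MvPolynomial.eval, MvPolynomial.eval₂Hom_bind₁]
  congr 2
  funext i
  split_ifs with h
  · simp
  · simp [hx i h]

theorem hasFDerivAt_eval (p : MvPolynomial (Fin n) ℝ) (x : Fin n → ℝ) :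
    HasFDerivAt (fun x : Fin n → ℝ => MvPolynomial.eval x p)
      (∑ j, MvPolynomial.eval x (MvPolynomial.pderiv j p) •
        (ContinuousLinearMap.proj j : (Fin n → ℝ) →L[ℝ] ℝ)) x := by
  induction p using MvPolynomial.induction_on with
  | C a => simpa using hasFDerivAt_const a x
  | add p q hp hq =>
    simp only [map_add, add_smul, Finset.sum_add_distrib]
    exact hp.add hq
  | mul_X p i hp =>
    have hX : HasFDerivAt (fun x : Fin n → ℝ => x i)
        (ContinuousLinearMap.proj i : (Fin n → ℝ) →L[ℝ] ℝ) x := hasFDerivAt_apply i x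
    have := hp.mul hX
    simp only [map_mul, MvPolynomial.eval_X]
    refine this.congr_fderiv ?_
    rw [Finset.smul_sum]
    have h1 : ∀ j, MvPolynomial.eval x (MvPolynomial.pderiv j (p * MvPolynomial.X i)) =
        (if j = i then MvPolynomial.eval x p else 0) +
          x i * MvPolynomial.eval x (MvPolynomial.pderiv j p) := by
      intro j
      rw [Derivation.leibniz, MvPolynomial.pderiv_X]
      by_cases h : j = i
      · subst h
        simp
      · simp [h, Ne.symm h]
    simp only [h1, add_smul, Finset.sum_add_distrib, ite_smul, zero_smul, Finset.sum_ite_eq',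
      Finset.mem_univ, if_true, mul_smul]

end CubicalForms

end

/-! ### Weak exterior derivative: cancellation across facets -/

noncomputable section

namespace CubicalForms

open MeasureTheory

namespace CubicalMesh

section Neighbours

variable {n : ℕ} {Ω : Set (Fin n → ℝ)} (𝒯 : CubicalMesh Ω)

/-- The traces of `w` on the faces common to two cells are single-valued. -/
def SingleValued (w : 𝒯.Broken) : Prop :=
  ∀ (T T' : 𝒯.cells) (f : Cell n), f.IsFaceOf T → f.IsFaceOf T' → f.trace (w T) = f.trace (w T')

variable {𝒯} {w : 𝒯.Broken} (hw : 𝒯.SingleValued w) (hΩ : IsOpen Ω) {i : Fin n}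
  {σ : Finset (Fin n)} (hi : i ∉ σ) {x : Fin n → ℝ} (hx : x ∈ Ω) (T : 𝒯.cells)
  (hxj : ∀ j ≠ i, x j ∈ Set.Ioo (T.1.lower j) (T.1.upper j))
include hw hΩ hi hx hxj

/-- Meant for `x` on a facet of `T` orthogonal to direction `i` and `s` a half-line beyond it. As `i
∉ σ`, `dx_σ` survives the pullback to the common facet, so the two coefficients agree at `x`. -/
theorem SingleValued.exists_adjacent (hxT : x ∈ T.1.carrier) {s : Set ℝ} (hs : x i ∈ closure s)
    (hs' : ∀ t ∈ s, t ∉ Set.Icc (T.1.lower i) (T.1.upper i)) :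
    ∃ T' : 𝒯.cells, (∀ j ≠ i, T'.1.lower j = T.1.lower j ∧ T'.1.upper j = T.1.upper j) ∧
      (x i = T'.1.lower i ∨ x i = T'.1.upper i) ∧
      (∃ t ∈ s, t ∈ Set.Icc (T'.1.lower i) (T'.1.upper i)) ∧
      MvPolynomial.eval x (w T' σ) = MvPolynomial.eval x (w T σ) := by
  obtain ⟨T', hT', hxT', z, hz, hzs⟩ := 𝒯.exists_mem_cell hΩ hx i hs
  obtain ⟨h1, h2, f, hf, hf', hd⟩ :=
    𝒯.exists_common_facet T.2 hT' hxT hxT' hxj hz (hs' _ hzs)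
  have hσ : σ ⊆ f.dirs := fun j hj => (hd j).1.2 fun h => hi (h ▸ hj)
  refine ⟨⟨T', hT'⟩, h1, h2, ⟨z i, hzs, hz.1 i, hz.2 i⟩, ?_⟩
  rw [← f.eval_trace _ hσ fun j => (hd j).2, ← f.eval_trace (w T) hσ fun j => (hd j).2,
    hw T ⟨T', hT'⟩ f hf hf']

theorem SingleValued.exists_above (hxi : x i = T.1.upper i) :
    ∃ T' : 𝒯.cells, (∀ j ≠ i, T'.1.lower j = T.1.lower j ∧ T'.1.upper j = T.1.upper j) ∧
      T'.1.lower i = T.1.upper i ∧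
      MvPolynomial.eval x (w T' σ) = MvPolynomial.eval x (w T σ) := by
  have hxT : x ∈ T.1.carrier := by
    refine ⟨fun j => ?_, fun j => ?_⟩ <;> by_cases hj : j = i
    · rw [hj, hxi]
      exact T.1.le i
    · exact (hxj j hj).1.le
    · rw [hj, hxi]
    · exact (hxj j hj).2.le
  obtain ⟨T', h1, h2, ⟨t, ht, ht'⟩, h3⟩ := hw.exists_adjacent hΩ hi hx T hxj hxT
    (s := Set.Ioi (x i)) (by simp) (fun t ht ht' => by
      rw [Set.mem_Ioi, hxi] at ht
      exact absurd ht'.2 (not_le.2 ht))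
  refine ⟨T', h1, ?_, h3⟩
  rcases h2 with h2 | h2
  · rw [← h2, hxi]
  · rw [Set.mem_Ioi, h2] at ht
    exact absurd ht'.2 (not_le.2 ht)

theorem SingleValued.exists_below (hxi : x i = T.1.lower i) :
    ∃ T' : 𝒯.cells, (∀ j ≠ i, T'.1.lower j = T.1.lower j ∧ T'.1.upper j = T.1.upper j) ∧
      T'.1.upper i = T.1.lower i ∧
      MvPolynomial.eval x (w T' σ) = MvPolynomial.eval x (w T σ) := by
  have hxT : x ∈ T.1.carrier := by
    refine ⟨fun j => ?_, fun j => ?_⟩ <;> by_cases hj : j = i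
    · rw [hj, hxi]
    · exact (hxj j hj).1.le
    · rw [hj, hxi]
      exact T.1.le i
    · exact (hxj j hj).2.le
  obtain ⟨T', h1, h2, ⟨t, ht, ht'⟩, h3⟩ := hw.exists_adjacent hΩ hi hx T hxj hxT
    (s := Set.Iio (x i)) (by simp) (fun t ht ht' => by
      rw [Set.mem_Iio, hxi] at ht
      exact absurd ht'.1 (not_le.2 ht))
  refine ⟨T', h1, ?_, h3⟩
  rcases h2 with h2 | h2
  · rw [Set.mem_Iio, h2] at ht
    exact absurd ht'.1 (not_le.2 ht)
  · rw [← h2, hxi]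

end Neighbours

variable {m : ℕ} {Ω : Set (Fin (m + 1) → ℝ)} {𝒯 : CubicalMesh Ω}

/-- The interior of the projection of a cell along the direction `i`. -/
def shadow (T : Cell (m + 1)) (i : Fin (m + 1)) : Set (Fin m → ℝ) :=
  Set.pi Set.univ fun j => Set.Ioo (T.lower (i.succAbove j)) (T.upper (i.succAbove j))

theorem insertNth_mem_Ioo {T : Cell (m + 1)} {i : Fin (m + 1)} {y : Fin m → ℝ}
    (hy : y ∈ shadow T i) (c : ℝ) (j : Fin (m + 1)) (hj : j ≠ i) :
    (i.insertNth c y : Fin (m + 1) → ℝ) j ∈ Set.Ioo (T.lower j) (T.upper j) := by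
  obtain ⟨j, rfl⟩ := Fin.exists_succAbove_eq hj
  rw [Fin.insertNth_apply_succAbove]
  exact hy j trivial

theorem shadow_congr {T T' : Cell (m + 1)} {i : Fin (m + 1)}
    (h : ∀ j ≠ i, T'.lower j = T.lower j ∧ T'.upper j = T.upper j) :
    shadow T' i = shadow T i := by
  unfold shadow
  congr 1
  funext j
  rw [(h _ (i.succAbove_ne j)).1, (h _ (i.succAbove_ne j)).2]

/-- Nondegenerate intervals with a common lower or a common upper end overlap, so some point over
`y` is interior to both cells. -/
theorem eq_of_mem_shadow {T T' : 𝒯.cells} {i : Fin (m + 1)} {y : Fin m → ℝ}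
    (hy : y ∈ shadow T.1 i) (hy' : y ∈ shadow T'.1 i)
    (h : T.1.lower i = T'.1.lower i ∨ T.1.upper i = T'.1.upper i) : T = T' := by
  have hT := 𝒯.nondegenerate T.1 T.2 i
  have hT' := 𝒯.nondegenerate T'.1 T'.2 i
  obtain ⟨c, hc1, hc2⟩ : ∃ c, max (T.1.lower i) (T'.1.lower i) < c ∧
      c < min (T.1.upper i) (T'.1.upper i) := by
    refine exists_between (max_lt (lt_min hT ?_) (lt_min ?_ hT'))
    · rcases h with h | h
      · rwa [h]
      · rwa [← h]
    · rcases h with h | h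
      · rwa [← h]
      · rwa [h]
  rw [max_lt_iff] at hc1
  rw [lt_min_iff] at hc2
  refine Subtype.ext (𝒯.eq_of_mem_interior T.2 T'.2 (x := i.insertNth c y) ?_ ?_) <;>
  · rw [Cell.mem_interior_carrier]
    intro j
    by_cases hj : j = i
    · subst hj
      rw [Fin.insertNth_apply_same]
      first
        | exact ⟨hc1.1, hc2.1⟩
        | exact ⟨hc1.2, hc2.2⟩
    · exact insertNth_mem_Ioo (by assumption) c j hj

/-- Where `φ ≠ 0` the point lies in `Ω`, so an upper facet there is the lower facet of the next
cell, with the same coefficient. Passing to that cell matches the nonzero terms of the two sums;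
facets in the boundary of `Ω` contribute nothing. -/
theorem SingleValued.sum_facet_eq {w : 𝒯.Broken} (hw : 𝒯.SingleValued w) (hΩ : IsOpen Ω)
    {i : Fin (m + 1)} {σ : Finset (Fin (m + 1))} (hi : i ∉ σ) {φ : (Fin (m + 1) → ℝ) → ℝ}
    (hφ : ∀ x ∉ Ω, φ x = 0) (y : Fin m → ℝ) :
    ∑ T : 𝒯.cells, Set.indicator (shadow T.1 i) (fun y =>
        MvPolynomial.eval (i.insertNth (T.1.upper i) y) (w T σ) *
          φ (i.insertNth (T.1.upper i) y)) y =
      ∑ T : 𝒯.cells, Set.indicator (shadow T.1 i) (fun y =>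
        MvPolynomial.eval (i.insertNth (T.1.lower i) y) (w T σ) *
          φ (i.insertNth (T.1.lower i) y)) y := by
  have hmem : ∀ {x}, φ x ≠ 0 → x ∈ Ω := fun h => by_contra fun hx => h (hφ _ hx)
  have up : ∀ T : 𝒯.cells, y ∈ shadow T.1 i → φ (i.insertNth (T.1.upper i) y) ≠ 0 →
      ∃ T' : 𝒯.cells, y ∈ shadow T'.1 i ∧ T'.1.lower i = T.1.upper i ∧
        MvPolynomial.eval (i.insertNth (T.1.upper i) y) (w T' σ) =
          MvPolynomial.eval (i.insertNth (T.1.upper i) y) (w T σ) := by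
    intro T hy h
    obtain ⟨T', h1, h2, h3⟩ := hw.exists_above hΩ hi (hmem h) T
      (insertNth_mem_Ioo hy _) (Fin.insertNth_apply_same _ _ _)
    exact ⟨T', shadow_congr h1 ▸ hy, h2, h3⟩
  have down : ∀ T : 𝒯.cells, y ∈ shadow T.1 i → φ (i.insertNth (T.1.lower i) y) ≠ 0 →
      ∃ T' : 𝒯.cells, y ∈ shadow T'.1 i ∧ T'.1.upper i = T.1.lower i ∧
        MvPolynomial.eval (i.insertNth (T.1.lower i) y) (w T' σ) =
          MvPolynomial.eval (i.insertNth (T.1.lower i) y) (w T σ) := by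
    intro T hy h
    obtain ⟨T', h1, h2, h3⟩ := hw.exists_below hΩ hi (hmem h) T
      (insertNth_mem_Ioo hy _) (Fin.insertNth_apply_same _ _ _)
    exact ⟨T', shadow_congr h1 ▸ hy, h2, h3⟩
  have hne : ∀ {T : 𝒯.cells} {c : ℝ}, Set.indicator (shadow T.1 i) (fun y =>
      MvPolynomial.eval (i.insertNth c y) (w T σ) * φ (i.insertNth c y)) y ≠ 0 →
      y ∈ shadow T.1 i ∧ φ (i.insertNth c y) ≠ 0 := fun h =>
    ⟨Set.mem_of_indicator_ne_zero h, fun h0 => h (by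
      rw [Set.indicator_of_mem (Set.mem_of_indicator_ne_zero h), h0, mul_zero])⟩
  choose! g hg1 hg2 hg3 using up
  -- `g T` is the cell above `T`. It is injective since a cell over `y` is determined by its upper
  -- end, and `down` yields surjectivity.
  refine Finset.sum_bij_ne_zero (fun T _ _ => g T) (fun _ _ _ => Finset.mem_univ _) ?_ ?_ ?_
  · intro T _ h T' _ h' e
    obtain ⟨hy, h⟩ := hne h
    obtain ⟨hy', h'⟩ := hne h'
    refine eq_of_mem_shadow hy hy' (Or.inr ?_)
    rw [← hg2 T hy h, ← hg2 T' hy' h', e]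
  · intro T _ h
    obtain ⟨hy, h0⟩ := hne h
    obtain ⟨T', h1, h2, h3⟩ := down T hy h0
    have h0' : φ (i.insertNth (T'.1.upper i) y) ≠ 0 := by rwa [h2]
    refine ⟨T', Finset.mem_univ _, ?_, ?_⟩
    · rwa [Set.indicator_of_mem h1, h2, h3, ← Set.indicator_of_mem hy (f := fun y =>
        MvPolynomial.eval (i.insertNth (T.1.lower i) y) (w T σ) *
          φ (i.insertNth (T.1.lower i) y))]
    · exact eq_of_mem_shadow (hg1 T' h1 h0') hy (Or.inl ((hg2 T' h1 h0').trans h2))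
  · intro T _ h
    obtain ⟨hy, h⟩ := hne h
    rw [Set.indicator_of_mem hy, Set.indicator_of_mem (hg1 T hy h), hg2 T hy h, hg3 T hy h]

theorem measurableSet_shadow (T : Cell (m + 1)) (i : Fin (m + 1)) :
    MeasurableSet (shadow T i) :=
  MeasurableSet.univ_pi fun _ => measurableSet_Ioo

theorem integral_shadow (T : Cell (m + 1)) (i : Fin (m + 1)) (g : (Fin m → ℝ) → ℝ) :
    ∫ y in Set.Icc (T.lower ∘ i.succAbove) (T.upper ∘ i.succAbove), g y =
      ∫ y, Set.indicator (shadow T i) g y := by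
  rw [integral_indicator (measurableSet_shadow T i)]
  exact setIntegral_congr_set Measure.univ_pi_Ioo_ae_eq_Icc.symm

theorem integrable_shadow (T : Cell (m + 1)) (i : Fin (m + 1)) {g : (Fin m → ℝ) → ℝ}
    (hg : Continuous g) : Integrable (Set.indicator (shadow T i) g) := by
  rw [integrable_indicator_iff (measurableSet_shadow T i)]
  refine (hg.integrableOn_Icc (a := T.lower ∘ i.succAbove) (b := T.upper ∘ i.succAbove)).mono_set ?_
  intro y hy
  exact ⟨fun j => (hy j trivial).1.le, fun j => (hy j trivial).2.le⟩

theorem SingleValued.sum_integral_facet {w : 𝒯.Broken} (hw : 𝒯.SingleValued w) (hΩ : IsOpen Ω)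
    {i : Fin (m + 1)} {σ : Finset (Fin (m + 1))} (hi : i ∉ σ) {φ : (Fin (m + 1) → ℝ) → ℝ}
    (hφc : Continuous φ) (hφ : ∀ x ∉ Ω, φ x = 0) :
    ∑ T : 𝒯.cells,
      ((∫ y in Set.Icc (T.1.lower ∘ i.succAbove) (T.1.upper ∘ i.succAbove),
          MvPolynomial.eval (i.insertNth (T.1.upper i) y) (w T σ) *
            φ (i.insertNth (T.1.upper i) y)) -
        ∫ y in Set.Icc (T.1.lower ∘ i.succAbove) (T.1.upper ∘ i.succAbove),
          MvPolynomial.eval (i.insertNth (T.1.lower i) y) (w T σ) *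
            φ (i.insertNth (T.1.lower i) y)) = 0 := by
  have hc : ∀ (T : 𝒯.cells) (c : ℝ), Continuous fun y : Fin m → ℝ =>
      MvPolynomial.eval (i.insertNth c y : Fin (m + 1) → ℝ) (w T σ) *
        φ (i.insertNth c y) := fun T c => by
    have : Continuous fun y : Fin m → ℝ => (i.insertNth c y : Fin (m + 1) → ℝ) :=
      continuous_const.finInsertNth i continuous_id
    exact ((MvPolynomial.continuous_eval _).comp this).mul (hφc.comp this)
  simp only [integral_shadow]
  rw [Finset.sum_sub_distrib, ← integral_finsetSum _ fun T _ => integrable_shadow T.1 i (hc T _),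
    ← integral_finsetSum _ fun T _ => integrable_shadow T.1 i (hc T _), sub_eq_zero]
  exact integral_congr_ae (Filter.Eventually.of_forall fun y => hw.sum_facet_eq hΩ hi hφ y)

/-- The divergence theorem for the vector field with components `± u_{ρ-i} φ`. Its divergence is the
integrand plus `φ (du)_ρ`, and the latter vanishes. -/
theorem _root_.CubicalForms.Cell.integral_eq_sum_facet (T : Cell (m + 1))
    {u : PolyForm (m + 1)} (hu : d u = 0) {φ : (Fin (m + 1) → ℝ) → ℝ} (hφ : ContDiff ℝ 1 φ)
    (ρ : Finset (Fin (m + 1))) :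
    ∫ x in T.carrier, ∑ i ∈ ρ, (eps i (ρ.erase i) : ℝ) * MvPolynomial.eval x (u (ρ.erase i)) *
        fderiv ℝ φ x (Pi.single i 1) =
      ∑ i ∈ ρ, (eps i (ρ.erase i) : ℝ) *
        ((∫ y in Set.Icc (T.lower ∘ i.succAbove) (T.upper ∘ i.succAbove),
          MvPolynomial.eval (i.insertNth (T.upper i) y) (u (ρ.erase i)) *
            φ (i.insertNth (T.upper i) y)) -
        ∫ y in Set.Icc (T.lower ∘ i.succAbove) (T.upper ∘ i.succAbove),
          MvPolynomial.eval (i.insertNth (T.lower i) y) (u (ρ.erase i)) *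
            φ (i.insertNth (T.lower i) y)) := by
  -- The signs are extended by `0` outside `ρ`, so that the field has a component in every
  -- direction.
  let c : Fin (m + 1) → ℝ := fun i => if i ∈ ρ then (eps i (ρ.erase i) : ℝ) else 0
  let F : Fin (m + 1) → (Fin (m + 1) → ℝ) → ℝ := fun i x =>
    c i * (MvPolynomial.eval x (u (ρ.erase i)) * φ x)
  let F' : Fin (m + 1) → (Fin (m + 1) → ℝ) → (Fin (m + 1) → ℝ) →L[ℝ] ℝ := fun i x =>
    c i • (MvPolynomial.eval x (u (ρ.erase i)) • fderiv ℝ φ x +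
      φ x • ∑ j, MvPolynomial.eval x (MvPolynomial.pderiv j (u (ρ.erase i))) •
        (ContinuousLinearMap.proj j : (Fin (m + 1) → ℝ) →L[ℝ] ℝ))
  have hF : ∀ i x, HasFDerivAt (F i) (F' i x) x := fun i x =>
    ((hasFDerivAt_eval _ x).mul
      (hφ.differentiable one_ne_zero x).hasFDerivAt).const_mul (c i)
  have hsum : ∀ x, ∑ i, F' i x (Pi.single i 1) = ∑ i ∈ ρ, (eps i (ρ.erase i) : ℝ) *
      MvPolynomial.eval x (u (ρ.erase i)) * fderiv ℝ φ x (Pi.single i 1) := by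
    intro x
    have h1 : ∀ i, F' i x (Pi.single i 1) =
        c i * MvPolynomial.eval x (u (ρ.erase i)) * fderiv ℝ φ x (Pi.single i 1) +
          φ x * (c i * MvPolynomial.eval x (MvPolynomial.pderiv i (u (ρ.erase i)))) := by
      intro i
      simp only [F', smul_apply, add_apply,
        sum_apply, ContinuousLinearMap.proj_apply, smul_eq_mul,
        Pi.single_apply, mul_ite, mul_one, mul_zero, Finset.sum_ite_eq', Finset.mem_univ, if_true]
      ring
    have h2 : ∑ i, c i * MvPolynomial.eval x (MvPolynomial.pderiv i (u (ρ.erase i))) = 0 := by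
      have h3 := congrArg (MvPolynomial.eval x) (congrFun hu ρ)
      rw [d_apply, map_sum, Pi.zero_apply, map_zero] at h3
      simpa [c, ite_mul, Finset.sum_ite_mem] using h3
    simp only [h1, Finset.sum_add_distrib, ← Finset.mul_sum, h2, mul_zero, add_zero]
    simp only [c, ite_mul, zero_mul, Finset.sum_ite_mem, Finset.univ_inter]
  have hcont : Continuous fun x => ∑ i, F' i x (Pi.single i 1) := by
    simp only [hsum]
    refine continuous_finsetSum _ fun i _ => ?_
    exact (continuous_const.mul (MvPolynomial.continuous_eval _)).mul
      ((hφ.continuous_fderiv one_ne_zero).clm_apply continuous_const)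
  have key := integral_divergence_of_hasFDerivAt_off_countable' T.lower T.upper T.le F F' ∅
    Set.countable_empty (fun i => (continuous_iff_continuousAt.2
      fun x => (hF i x).continuousAt).continuousOn) (fun x _ i => hF i x)
    hcont.integrableOn_Icc
  simp only [hsum] at key
  refine Eq.trans key ?_
  simp only [F, integral_const_mul, ← mul_sub]
  simp only [c, ite_mul, zero_mul, Finset.sum_ite_mem, Finset.univ_inter]

end CubicalMesh

theorem CubicalMesh.SingleValued.hasExtDeriv_zero {n : ℕ} {Ω : Set (Fin n → ℝ)}
    {𝒯 : CubicalMesh Ω} {w : 𝒯.Broken} (hw : 𝒯.SingleValued w) (hΩ : IsOpen Ω)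
    (hd : ∀ T, d (w T) = 0) : HasExtDeriv Ω (𝒯.toForm w) 0 := by
  refine ⟨𝒯.memLp_toForm w, fun σ => MemLp.zero, fun φ hφ _ hsupp ρ => ?_⟩
  -- In dimension `0` only `ρ = ∅` occurs and the sum is empty; the facets of a cell need dimension
  -- `m + 1`.
  rcases n with _ | m
  · simp [Finset.eq_empty_of_isEmpty ρ]
  have hφ1 : ContDiff ℝ 1 φ := hφ.of_le (by exact_mod_cast le_top)
  have h1 : ∀ x, ∑ i ∈ ρ, (eps i (ρ.erase i) : ℝ) * 𝒯.toForm w x (ρ.erase i) *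
      fderiv ℝ φ x (Pi.single i 1) = ∑ T : 𝒯.cells, Set.indicator (interior T.1.carrier)
        (fun x => ∑ i ∈ ρ, (eps i (ρ.erase i) : ℝ) * MvPolynomial.eval x (w T (ρ.erase i)) *
          fderiv ℝ φ x (Pi.single i 1)) x := by
    intro x
    simp only [CubicalMesh.toForm, Finset.mul_sum, Finset.sum_mul]
    rw [Finset.sum_comm]
    refine Finset.sum_congr rfl fun T _ => ?_
    by_cases hx : x ∈ interior T.1.carrier <;> simp [hx]
  simp only [h1]
  have h2 : ∀ T : 𝒯.cells, Continuous fun x => ∑ i ∈ ρ, (eps i (ρ.erase i) : ℝ) *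
      MvPolynomial.eval x (w T (ρ.erase i)) * fderiv ℝ φ x (Pi.single i 1) := fun T =>
    continuous_finsetSum _ fun i _ =>
      (continuous_const.mul (MvPolynomial.continuous_eval _)).mul
        ((hφ1.continuous_fderiv one_ne_zero).clm_apply continuous_const)
  rw [𝒯.integral_sum_indicator h2]
  simp only [fun T : 𝒯.cells => T.1.integral_eq_sum_facet (hd T) hφ1 ρ]
  rw [Finset.sum_comm]
  simp only [← Finset.mul_sum]
  rw [Finset.sum_eq_zero fun i _ => ?_]
  · simp
  · rw [hw.sum_integral_facet hΩ (Finset.notMem_erase i ρ) hφ.continuous, mul_zero]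
    exact fun x hx => image_eq_zero_of_notMem_tsupport fun h => hx (hsupp h)

end CubicalForms

end

/-! ### The projection on the mesh and the theorem -/

noncomputable section

namespace CubicalForms

namespace CubicalMesh

variable {n : ℕ} {Ω : Set (Fin n → ℝ)} (𝒯 : CubicalMesh Ω)

theorem SingleValued.sub {𝒯 : CubicalMesh Ω} {u w : 𝒯.Broken} (hu : 𝒯.SingleValued u)
    (hw : 𝒯.SingleValued w) : 𝒯.SingleValued (u - w) := by
  intro T T' f hf hf'
  funext σ
  by_cases hσ : σ ⊆ f.dirs
  · have h1 := congrFun (hu T T' f hf hf') σ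
    have h2 := congrFun (hw T T' f hf hf') σ
    rw [f.trace_of_subset _ hσ, f.trace_of_subset _ hσ] at h1 h2 ⊢
    simp only [Pi.sub_apply, map_sub, h1, h2]
  · rw [f.trace_of_not_subset _ hσ, f.trace_of_not_subset _ hσ]

/-- The canonical projection onto `Q_r^- Λ^k(𝒯)`. -/
def meshProj {r : ℕ} (hr : 1 ≤ r) (k : ℕ) : 𝒯.QtildeSpace r k →ₗ[ℝ] 𝒯.QminusSpace r k where
  toFun u := ⟨fun T => proj T.1 r (u.1 T),
    fun T => proj_mem_Qminus (𝒯.nondegenerate T.1 T.2)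
      fun _ hσ => Qtilde_apply_eq_zero (u.2.1 T) hσ,
    fun T T' f hf hf' => trace_proj_congr (𝒯.nondegenerate T.1 T.2)
      (𝒯.nondegenerate T'.1 T'.2) hr hf hf' (u.2.2 T T' f hf hf')⟩
  map_add' u v := Subtype.ext (funext fun T => map_add (proj T.1 r) (u.1 T) (v.1 T))
  map_smul' c u := Subtype.ext (funext fun T => map_smul (proj T.1 r) c (u.1 T))

theorem meshProj_apply {r : ℕ} (hr : 1 ≤ r) (k : ℕ) (u : 𝒯.QtildeSpace r k) (T : 𝒯.cells) :
    (𝒯.meshProj hr k u : 𝒯.Broken) T = proj T.1 r (u.1 T) := rfl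

theorem meshProj_eq_iff {r k : ℕ} (hr : 1 ≤ r) (u : 𝒯.QtildeSpace r k) (w : 𝒯.QminusSpace r k) :
    𝒯.meshProj hr k u = w ↔ 𝒯.SameDOFs r k u w := by
  constructor
  · rintro rfl T f hf _ v hv
    exact integral_proj (𝒯.nondegenerate T.1 T.2) hr hf _ hv
  · intro h
    refine Subtype.ext (funext fun T => ?_)
    -- Replace `w` by `proj w`: the degrees of freedom determine projections.
    rw [meshProj_apply, ← proj_of_mem_Qminus (𝒯.nondegenerate T.1 T.2) (w.2.1 T)]
    exact (proj_congr_of_dofs (𝒯.nondegenerate T.1 T.2) hr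
      (fun _ hσ => Qtilde_apply_eq_zero (u.2.1 T) hσ) (fun σ hσ => (Qminus_le (w.2.1 T) σ).2 hσ)
      (h T)).symm

theorem hasExtDeriv_sub_meshProj (hΩ : IsOpen Ω) {r k : ℕ} (hr : 1 ≤ r)
    (u : 𝒯.QtildeSpace r k) :
    HasExtDeriv Ω (𝒯.toForm (u - 𝒯.meshProj hr k u : 𝒯.Broken)) 0 :=
  (SingleValued.sub u.2.2 (𝒯.meshProj hr k u).2.2).hasExtDeriv_zero hΩ
    fun T => d_sub_proj (𝒯.nondegenerate T.1 T.2) (u.2.1 T)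

end CubicalMesh

theorem exists_meshProj_bound (n r : ℕ) (hr : 1 ≤ r) (k : ℕ) :
    ∃ C : ℝ, 0 < C ∧ ∀ (Ω : Set (Fin n → ℝ)) (𝒯 : CubicalMesh Ω) (u : 𝒯.QtildeSpace r k),
      l2Norm Ω (𝒯.toForm (𝒯.meshProj hr k u)) ≤ C * l2Norm Ω (𝒯.toForm u) := by
  -- Partial degrees less than `r + 2` suffice by `Qtilde_mem_boxDeg`. The estimate concerns squared
  -- norms, whence the square root of `C`.
  obtain ⟨C, hC, h⟩ := exists_proj_bound n r (r + 2)
  refine ⟨Real.sqrt C, Real.sqrt_pos.2 hC, fun Ω 𝒯 u => ?_⟩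
  rw [𝒯.l2Norm_toForm, 𝒯.l2Norm_toForm, ← Real.sqrt_mul hC.le]
  refine Real.sqrt_le_sqrt ?_
  rw [Finset.mul_sum]
  refine Finset.sum_le_sum fun T _ => ?_
  rw [Finset.mul_sum]
  exact Finset.sum_le_sum fun σ _ => h T.1 (𝒯.nondegenerate T.1 T.2) (u.1 T)
    (Qtilde_mem_boxDeg (u.2.1 T)) σ

end CubicalForms

end

theorem mainTheorem6 (n r k : ℕ) (hr : 1 ≤ r) (hk : k ≤ n) :
    ∃ C : ℝ, 0 < C ∧
      ∀ Ω : Set (Fin n → ℝ), IsOpen Ω → IsConnected Ω →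
      ∀ 𝒯 : CubicalForms.CubicalMesh Ω,
      ∃ P : 𝒯.QtildeSpace r k →ₗ[ℝ] 𝒯.QminusSpace r k,
        (∀ (u : 𝒯.QtildeSpace r k) (w : 𝒯.QminusSpace r k),
          P u = w ↔ 𝒯.SameDOFs r k u w) ∧
        (∀ u : 𝒯.QtildeSpace r k,
          CubicalForms.l2Norm Ω (𝒯.toForm (P u)) ≤ C * CubicalForms.l2Norm Ω (𝒯.toForm u)) ∧
        ∀ u : 𝒯.QtildeSpace r k,
          CubicalForms.HasExtDeriv Ω (𝒯.toForm (u - P u : 𝒯.Broken)) 0 := by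
  obtain ⟨C, hC, h⟩ := CubicalForms.exists_meshProj_bound n r hr k
  exact ⟨C, hC, fun Ω hΩ _ 𝒯 => ⟨𝒯.meshProj hr k, 𝒯.meshProj_eq_iff hr, h Ω 𝒯,
    𝒯.hasExtDeriv_sub_meshProj hΩ hr⟩⟩
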